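/- Let $k$ be a field and let $A$ be a finite-dimensional connected ($A_n=0$ for $n<0$, $A_0=k$) $\mathbb Z$-graded cocommutative Hopf algebra over $k$ (with the Koszul sign rule), and assume that $A$ is nontrivial, i.e. $A\neq k$. Let a tower under $A$ with $\ell+1$ storeys be given: finite-dimensional connected graded cocommutative Hopf algebras $A=A_0,A_1,\dots,A_{\ell+1}=k$ and $M_0,\dots,M_\ell$ over $k$, where each $M_j$ is monogenic (generated as an algebra by one homogeneous element), together with morphisms of graded Hopf algebras $M_j\to A_j\to A_{j+1}$, $0\le j\le \ell$, which are Hopf algebra extensions, i.e. there is a graded isomorphism $A_j\cong M_j\otimes_k A_{j+1}$ of left $M_j$-modules and right $A_{j+1}$-comodules. Let $\mathrm{StMod}_A$ be the (small) stable module category of $A$: its objects are the finitely generated graded left $A$-modules, its morphisms are degree-preserving $A$-linear maps modulo those which factor through a projective module, and its cofiber sequences are those isomorphic to the image of a short exact sequence of modules. Let $X\mapsto X(t)$ be the twist, $X(t)_n=X_{n-t}$, write $\mathrm{tw}=(1)$, and regard each $A_j$ as an object of $\mathrm{StMod}_A$ by restriction along $A\to A_1\to\dots\to A_j$. Suppose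 that there are integers $1\le b_1<\dots<b_h<\ell$ such that for each $i$ the object $A_{b_i+1}$ lies in the thick subcategory of $\mathrm{StMod}_A$ generated by $\{A_{b_i}(t) : t\in T_i\}$ for some finite set $T_i\subset\mathbb Z$. Then $$h_{\mathrm{pol}}(\mathrm{tw})\le \ell-h .$$ Here a generator of $\mathrm{StMod}_A$ is an object $G$ such that the thick subcategory generated by $G$ is all of $\mathrm{StMod}_A$. For objects $X,Y$, the complexity $\delta(X,Y)\in\mathbb N\cup\{\infty\}$ is the least $m$ for which there is a filtration $0=Y_0\to Y_1\to\dots\to Y_m$ with each $\mathrm{cofib}(Y_{i-1}\to Y_i)$ equivalent to a shift $X[n_i]$, $n_i\in\mathbb Z$, and with $Y$ a retract of $Y_m$. For an exact endofunctor $F$ and a generator $G$, $$h_{\mathrm{cat}}(F)=\lim_{n\to\infty}\frac{\log\delta(G,F^nG)}{n},\qquad h_{\mathrm{pol}}(F)=\limsup_{n\to\infty}\frac{\log\delta(G,F^nG)-n\,h_{\mathrm{cat}}(F)}{\log n}.$$ The assertion includes that $\mathrm{StMod}_A$ has a generator, and the bound holds for $h_{\mathrm{pol}}(\mathrm{tw})$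 computed with any generator. -/

import Mathlib

open CategoryTheory CategoryTheory.Limits Filter TensorProduct

universe u

noncomputable section

/-! ### Graded Hopf algebras -/

/-- The degree `n` part `⨁ₘ 𝒜 m ⊗ ℬ (n - m)` of the tensor product of two graded vector spaces. -/
def tensorDeg {k A B : Type*} [Field k] [AddCommGroup A] [Module k A] [AddCommGroup B] [Module k B]
    (𝒜 : ℤ → Submodule k A) (ℬ : ℤ → Submodule k B) (n : ℤ) : Submodule k (A ⊗[k] B) :=
  ⨆ m : ℤ, Submodule.map₂ (TensorProduct.mk k A B) (𝒜 m) (ℬ (n - m))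

/-- A finite-dimensional connected `ℤ`-graded cocommutative Hopf algebra over the field `k`.
All sign conventions are the Koszul ones: `GradedTensorProduct k deg deg` is the tensor product
algebra with `(a ⊗ b) * (a' ⊗ b') = (-1) ^ (|b| * |a'|) • (a * a') ⊗ (b * b')`, and
`GradedTensorProduct.comm` is the symmetry `a ⊗ b ↦ (-1) ^ (|a| * |b|) • b ⊗ a`. -/
structure GrHopf (k : Type u) [Field k] where
  carrier : Type u
  [ring : Ring carrier]
  [algebra : Algebra k carrier]
  [coalgebra : Coalgebra k carrier]
  deg : ℤ → Submodule k carrier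
  [graded : GradedAlgebra deg]
  /-- The comultiplication is a morphism of graded algebras into the graded tensor product. -/
  comul_deg : ∀ (n : ℤ), ∀ a ∈ deg n,
    (Coalgebra.comul a : carrier ⊗[k] carrier) ∈ tensorDeg deg deg n
  comul_one : GradedTensorProduct.of k deg deg (Coalgebra.comul 1) = 1
  comul_mul : ∀ a b : carrier, GradedTensorProduct.of k deg deg (Coalgebra.comul (a * b)) =
    GradedTensorProduct.of k deg deg (Coalgebra.comul a) *
      GradedTensorProduct.of k deg deg (Coalgebra.comul b)
  /-- The counit is a morphism of graded algebras. -/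
  counit_deg : ∀ n : ℤ, n ≠ 0 → ∀ a ∈ deg n, Coalgebra.counit (R := k) a = 0
  counit_one : Coalgebra.counit (R := k) (1 : carrier) = 1
  counit_mul : ∀ a b : carrier, Coalgebra.counit (R := k) (a * b) =
    Coalgebra.counit (R := k) a * Coalgebra.counit (R := k) b
  /-- The antipode is a morphism of graded algebras to the (graded) opposite algebra. -/
  antipode : carrier →ₗ[k] carrier
  antipode_deg : ∀ (n : ℤ), ∀ a ∈ deg n, antipode a ∈ deg n
  antipode_one : antipode 1 = 1
  antipode_mul : ∀ (m n : ℤ), ∀ a ∈ deg m, ∀ b ∈ deg n,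
    antipode (a * b) = (m * n).negOnePow • (antipode b * antipode a)
  mul_antipode_rTensor_comul : ∀ a : carrier,
    LinearMap.mul' k carrier (antipode.rTensor carrier (Coalgebra.comul a)) =
      algebraMap k carrier (Coalgebra.counit a)
  mul_antipode_lTensor_comul : ∀ a : carrier,
    LinearMap.mul' k carrier (antipode.lTensor carrier (Coalgebra.comul a)) =
      algebraMap k carrier (Coalgebra.counit a)
  /-- Graded cocommutativity. -/
  cocomm : ∀ a : carrier,
    GradedTensorProduct.comm deg deg (GradedTensorProduct.of k deg deg (Coalgebra.comul a)) =
      GradedTensorProduct.of k deg deg (Coalgebra.comul a)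
  /-- Connectedness. -/
  deg_neg : ∀ n : ℤ, n < 0 → deg n = ⊥
  deg_zero : deg 0 = Submodule.span k {1}
  finite : Module.Finite k carrier

namespace GrHopf

variable {k : Type u} [Field k]

instance : CoeSort (GrHopf k) (Type u) := ⟨GrHopf.carrier⟩
instance (A : GrHopf k) : Ring A := A.ring
instance (A : GrHopf k) : Algebra k A := A.algebra
instance (A : GrHopf k) : Coalgebra k A := A.coalgebra
instance (A : GrHopf k) : GradedAlgebra A.deg := A.graded
instance (A : GrHopf k) : Module.Finite k A := A.finite

/-- `A` is the trivial Hopf algebra `k`. -/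
def IsTrivial (A : GrHopf k) : Prop := Function.Bijective (algebraMap k A)

/-- `A` is generated as an algebra by a single (homogeneous) element. -/
def IsMonogenic (A : GrHopf k) : Prop :=
  ∃ (d : ℤ) (x : A), x ∈ A.deg d ∧ Algebra.adjoin k {x} = ⊤

/-- Morphisms of graded Hopf algebras (these automatically commute with the antipodes). -/
structure Hom (A B : GrHopf k) where
  toBialgHom : A →ₐc[k] B
  map_deg : ∀ (n : ℤ), ∀ a ∈ A.deg n, toBialgHom a ∈ B.deg n

namespace Hom

instance (A B : GrHopf k) : CoeFun (Hom A B) (fun _ => A → B) := ⟨fun f => f.toBialgHom⟩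

/-- The identity morphism. -/
def id (A : GrHopf k) : Hom A A := ⟨BialgHom.id k A, fun _ _ h => h⟩

/-- The composite `g ∘ f`. -/
def comp {A B C : GrHopf k} (g : Hom B C) (f : Hom A B) : Hom A C :=
  ⟨g.toBialgHom.comp f.toBialgHom, fun n a ha => g.map_deg n _ (f.map_deg n a ha)⟩

/-- The underlying ring homomorphism. -/
def toRingHom {A B : GrHopf k} (f : Hom A B) : A →+* B := ((f.toBialgHom : A →ₐ[k] B) : A →+* B)

end Hom

/-- `i : A → B`, `p : B → C` exhibit `B` as a Hopf algebra extension of `C` by `A`: there is an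
isomorphism of graded vector spaces `φ : B ≃ A ⊗ C` which is left `A`-linear (for the action of `A`
on `B` through `i`) and right `C`-colinear (for the coaction `(id ⊗ p) ∘ Δ` of `C` on `B`). -/
def IsExtension {A B C : GrHopf k} (i : Hom A B) (p : Hom B C) : Prop :=
  ∃ φ : B ≃ₗ[k] A ⊗[k] C,
    (∀ (n : ℤ), ∀ b ∈ B.deg n, φ b ∈ tensorDeg A.deg C.deg n) ∧
    (∀ (a : A) (b : B), φ (i a * b) = (LinearMap.mulLeft k a).rTensor C (φ b)) ∧
    (∀ b : B,
      φ.toLinearMap.rTensor C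
          (((p.toBialgHom : B →ₗc[k] C) : B →ₗ[k] C).lTensor B (Coalgebra.comul b)) =
        (TensorProduct.assoc k A C C).symm
          ((Coalgebra.comul (R := k) (A := C)).lTensor A (φ b)))

end GrHopf

/-- A tower under `A` with `ℓ + 1` storeys: Hopf algebras `A₀ = A, A₁, …, A_{ℓ+1}`, where
`A_{j+1} = next j`, and monogenic Hopf algebras `M₀, …, M_ℓ`, together with Hopf algebra extensions
`M_j → A_j → A_{j+1}` for `0 ≤ j ≤ ℓ`, such that `A_{ℓ+1} = k`. -/
structure HopfTower {k : Type u} [Field k] (A : GrHopf k) (ℓ : ℕ) where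
  next : Fin (ℓ + 1) → GrHopf k
  M : Fin (ℓ + 1) → GrHopf k
  incl : ∀ j : Fin (ℓ + 1),
    GrHopf.Hom (M j) ((Fin.cons A next : Fin (ℓ + 2) → GrHopf k) j.castSucc)
  proj : ∀ j : Fin (ℓ + 1),
    GrHopf.Hom ((Fin.cons A next : Fin (ℓ + 2) → GrHopf k) j.castSucc) (next j)
  isExtension : ∀ j, GrHopf.IsExtension (incl j) (proj j)
  isMonogenic : ∀ j, (M j).IsMonogenic
  isTrivial_last : (next (Fin.last ℓ)).IsTrivial

namespace HopfTower

variable {k : Type u} [Field k] {A : GrHopf k} {ℓ : ℕ} (T : HopfTower A ℓ)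

/-- The Hopf algebra `A_j`, `0 ≤ j ≤ ℓ + 1`. -/
def stage : Fin (ℓ + 2) → GrHopf k := Fin.cons A T.next

/-- The composite `A = A₀ → A₁ → ⋯ → A_j`. -/
def toStage (j : Fin (ℓ + 2)) : GrHopf.Hom A (T.stage j) :=
  Fin.induction (motive := fun j => GrHopf.Hom A (T.stage j)) (GrHopf.Hom.id A)
    (fun j f => GrHopf.Hom.comp (B := T.stage j.castSucc) (T.proj j) f) j

end HopfTower

/-! ### Graded modules -/

/-- A finitely generated graded left module over the graded algebra `A`. -/
structure GrMod {k : Type u} [Field k] (A : GrHopf k) where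
  carrier : Type u
  [addCommGroup : AddCommGroup carrier]
  [module : Module A carrier]
  deg : ℤ → AddSubgroup carrier
  isInternal : DirectSum.IsInternal deg
  smul_deg : ∀ (i j : ℤ), ∀ a ∈ A.deg i, ∀ m ∈ deg j, a • m ∈ deg (i + j)
  finite : Module.Finite A carrier

namespace GrMod

variable {k : Type u} [Field k] {A : GrHopf k}

instance : CoeSort (GrMod A) (Type u) := ⟨GrMod.carrier⟩
instance (M : GrMod A) : AddCommGroup M := M.addCommGroup
instance (M : GrMod A) : Module A M := M.module

/-- Degree-preserving `A`-linear maps. -/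
@[ext]
structure Hom (M N : GrMod A) where
  toLinearMap : M →ₗ[A] N
  map_deg : ∀ (n : ℤ), ∀ m ∈ M.deg n, toLinearMap m ∈ N.deg n

instance : Category (GrMod A) where
  Hom := Hom
  id M := ⟨LinearMap.id, fun _ _ h => h⟩
  comp f g := ⟨g.toLinearMap ∘ₗ f.toLinearMap, fun n m h => g.map_deg n _ (f.map_deg n m h)⟩

/-- The underlying linear map of a morphism. -/
def lin {M N : GrMod A} (f : M ⟶ N) : M →ₗ[A] N := Hom.toLinearMap f

/-- Short exact sequences `0 → X → Y → Z → 0` of graded modules. -/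
def IsShortExact {X Y Z : GrMod A} (f : X ⟶ Y) (g : Y ⟶ Z) : Prop :=
  Function.Injective (lin f) ∧ Function.Exact (lin f) (lin g) ∧ Function.Surjective (lin g)

/-- Two morphisms are identified in the stable category if their difference factors through a
projective module. (A graded module is projective in the category of graded modules if and only if
its underlying module is projective.) -/
def stableRel (A : GrHopf k) : HomRel (GrMod A) := fun X Y f g =>
  ∃ (P : GrMod A) (a : X ⟶ P) (b : P ⟶ Y), Module.Projective A P ∧
    ∀ x : X, lin f x - lin g x = lin b (lin a x)

/-- Translating a grading gives a grading. -/
theorem isInternal_shift {M : Type*} [AddCommGroup M] {𝓜 : ℤ → AddSubgroup M}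
    (h : DirectSum.IsInternal 𝓜) (t : ℤ) : DirectSum.IsInternal (fun n => 𝓜 (n - t)) := by
  have key : (DirectSum.coeAddMonoidHom (fun n => 𝓜 ((Equiv.addRight t).symm n))).comp
      (DirectSum.equivCongrLeft (β := fun n => 𝓜 n) (Equiv.addRight t)).toAddMonoidHom =
      DirectSum.coeAddMonoidHom 𝓜 := by
    ext i x
    obtain ⟨j, rfl⟩ : ∃ j, i = (Equiv.addRight t).symm j := ⟨i + t, by simp⟩
    exact (congrArg _ (DirectSum.equivCongrLeft_of (β := fun n => 𝓜 n) _ j x)).trans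
      ((DirectSum.coeAddMonoidHom_of (fun n => 𝓜 ((Equiv.addRight t).symm n)) j x).trans
        (DirectSum.coeAddMonoidHom_of 𝓜 _ x).symm)
  have h' : Function.Bijective (DirectSum.coeAddMonoidHom 𝓜) := h
  rw [← key, AddMonoidHom.coe_comp] at h'
  have h'' := (Function.Bijective.of_comp_iff _
    (DirectSum.equivCongrLeft (β := fun n => 𝓜 n) (Equiv.addRight t)).bijective).1 h'
  have e : (fun n => 𝓜 ((Equiv.addRight t).symm n)) = fun n => 𝓜 (n - t) := by
    funext n
    simp [sub_eq_add_neg]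
  rw [← e]
  exact h''

/-- The twist `M ↦ M(t)`, where `M(t)ₙ = M_{n - t}`. -/
def twistObj (t : ℤ) (M : GrMod A) : GrMod A where
  carrier := M
  deg n := M.deg (n - t)
  isInternal := isInternal_shift M.isInternal t
  smul_deg i j a ha m hm := by
    have := M.smul_deg i (j - t) a ha m hm
    rwa [← add_sub_assoc] at this
  finite := M.finite

/-- The twist functor `(t)` on graded modules. -/
def twist (A : GrHopf k) (t : ℤ) : GrMod A ⥤ GrMod A where
  obj M := twistObj t M
  map {M N} f :=
    { toLinearMap := (lin f : M →ₗ[A] N)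
      map_deg := fun n m h => Hom.map_deg f (n - t) m h }

end GrMod

/-- The Hopf algebra `A_j` of a tower under `A`, regarded as a graded left `A`-module by restriction
along `A → A_j`. -/
def HopfTower.stageMod {k : Type u} [Field k] {A : GrHopf k} {ℓ : ℕ} (T : HopfTower A ℓ)
    (j : Fin (ℓ + 2)) : GrMod A :=
  letI : Module A (T.stage j) := Module.compHom (T.stage j) (T.toStage j).toRingHom
  { carrier := T.stage j
    deg := fun n => ((T.stage j).deg n).toAddSubgroup
    isInternal := DirectSum.Decomposition.isInternal (T.stage j).deg
    smul_deg := fun m n a ha x hx =>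
      SetLike.GradedMul.mul_mem ((T.toStage j).map_deg m a ha) hx
    finite := by
      have : IsScalarTower k A (T.stage j) := ⟨fun c a x => by
        change (T.toStage j).toBialgHom (c • a) * x = c • ((T.toStage j).toBialgHom a * x)
        rw [map_smul, smul_mul_assoc]⟩
      exact Module.Finite.of_restrictScalars_finite k A (T.stage j) }

/-! ### The stable module category -/

/-- The (homotopy category of the) small stable module category of `A`: the objects are the finitely
generated graded `A`-modules, the morphisms are the morphisms of graded modules modulo those which
factor through a projective module. -/
abbrev StMod {k : Type u} [Field k] (A : GrHopf k) : Type (u + 1) :=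
  CategoryTheory.Quotient (GrMod.stableRel A)

namespace StMod

variable {k : Type u} [Field k] {A : GrHopf k}

/-- The stable module category functor. -/
abbrev Q (A : GrHopf k) : GrMod A ⥤ StMod A := CategoryTheory.Quotient.functor (GrMod.stableRel A)

/-- The functor `X ↦ X(t)` on the stable module category. -/
def twist (A : GrHopf k) (t : ℤ) : StMod A ⥤ StMod A :=
  CategoryTheory.Quotient.lift _ (GrMod.twist A t ⋙ Q A) (by
    rintro X Y f g ⟨P, a, b, hP, h⟩
    exact CategoryTheory.Quotient.sound _ ⟨(GrMod.twist A t).obj P, (GrMod.twist A t).map a,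
      (GrMod.twist A t).map b, hP, h⟩)

/-- The twist functor `tw = (1)`. -/
abbrev tw (A : GrHopf k) : StMod A ⥤ StMod A := twist A 1

/-- Cofiber sequences `X → Y → Z` in the triangulated category `StMod A`: the sequences isomorphic
to the image of a short exact sequence of graded modules. -/
def IsCofiberSeq {X Y Z : StMod A} (f : X ⟶ Y) (g : Y ⟶ Z) : Prop :=
  ∃ (X' Y' Z' : GrMod A) (i : X' ⟶ Y') (p : Y' ⟶ Z'), GrMod.IsShortExact i p ∧
    ∃ (a : X ≅ (Q A).obj X') (b : Y ≅ (Q A).obj Y') (c : Z ≅ (Q A).obj Z'),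
      f ≫ b.hom = a.hom ≫ (Q A).map i ∧ g ≫ c.hom = b.hom ≫ (Q A).map p

/-- `Y` is a suspension of `X` (and `X` is a desuspension of `Y`): there is a cofiber sequence
`X → 0 → Y`. -/
def IsSuspension (X Y : StMod A) : Prop :=
  ∃ (Z : StMod A) (f : X ⟶ Z) (g : Z ⟶ Y), IsZero Z ∧ IsCofiberSeq f g

/-- `IsShift X n Y` means that `Y ≃ X[n]`, the `n`-fold suspension of `X`, where `n ∈ ℤ`. -/
inductive IsShift (X : StMod A) : ℤ → StMod A → Prop
  | zero {Y : StMod A} (e : X ≅ Y) : IsShift X 0 Y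
  | suspension {n : ℤ} {Y Y' : StMod A} :
      IsShift X n Y → IsSuspension Y Y' → IsShift X (n + 1) Y'
  | desuspension {n : ℤ} {Y Y' : StMod A} :
      IsShift X n Y → IsSuspension Y' Y → IsShift X (n - 1) Y'

/-- Thick subcategories: stable subcategories which are closed under retracts. -/
structure IsThick (P : ObjectProperty (StMod A)) : Prop where
  zero : ∀ X, IsZero X → P X
  left : ∀ {X Y Z} (f : X ⟶ Y) (g : Y ⟶ Z), IsCofiberSeq f g → P Y → P Z → P X
  middle : ∀ {X Y Z} (f : X ⟶ Y) (g : Y ⟶ Z), IsCofiberSeq f g → P X → P Z → P Y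
  right : ∀ {X Y Z} (f : X ⟶ Y) (g : Y ⟶ Z), IsCofiberSeq f g → P X → P Y → P Z
  retract : ∀ {X Y} (_ : Retract X Y), P Y → P X

/-- The thick subcategory generated by a set of objects. -/
def thick (S : Set (StMod A)) : ObjectProperty (StMod A) := fun Y =>
  ∀ P : ObjectProperty (StMod A), IsThick P → (∀ X ∈ S, P X) → P Y

/-- `G` is a generator: the thick subcategory generated by `G` is everything. -/
def IsGenerator (G : StMod A) : Prop := ∀ Y, thick {G} Y

/-- The complexity `δ(X, Y)`: the least length `ℓ` of a filtration `0 = Y₀ → Y₁ → ⋯ → Y_ℓ` with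
`cofib (Y_i → Y_{i+1}) ≃ X[n_i]` such that `Y` is a retract of `Y_ℓ` (and `∞` if there is none). -/
def complexity (X Y : StMod A) : ℕ∞ :=
  ⨅ (ℓ : ℕ) (_ : ∃ F : ℕ → StMod A, IsZero (F 0) ∧
      (∀ i < ℓ, ∃ (Z : StMod A) (f : F i ⟶ F (i + 1)) (g : F (i + 1) ⟶ Z) (n : ℤ),
        IsCofiberSeq f g ∧ IsShift X n Z) ∧
      Nonempty (Retract Y (F ℓ))), (ℓ : ℕ∞)

/-- `log δ(G, Fⁿ G)`, with `log 0 = -∞` and `log ∞ = ∞`. -/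
def logComplexity (F : StMod A ⥤ StMod A) (G : StMod A) (n : ℕ) : EReal :=
  ENNReal.log ((complexity G (F.obj^[n] G) : ℕ∞) : ENNReal)

/-- The categorical entropy of `F`, computed with the generator `G`: the limit of
`log δ(G, Fⁿ G) / n`. (The limit exists, since `log δ(G, Fⁿ G)` is subadditive in `n`.) -/
def catEntropy (F : StMod A ⥤ StMod A) (G : StMod A) : EReal :=
  limsup (fun n : ℕ => logComplexity F G n / (n : EReal)) atTop

/-- The categorical polynomial entropy of `F`, computed with the generator `G`. -/
def polEntropy (F : StMod A ⥤ StMod A) (G : StMod A) : EReal :=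
  limsup (fun n : ℕ =>
    (logComplexity F G n - (n : EReal) * catEntropy F G) / ((Real.log n : ℝ) : EReal)) atTop

end StMod

end

/-! The proof bounds the number of cells needed to build `G(n)` from `G` by a polynomial in `n` of
degree `ℓ - h`.

Consider one storey `M → B → C`, where `M = k[x]/(x^(N+1))` and `x` has degree `d > 0`. The kernel
`K` of `B → C` is `Bx`, and right multiplication by `x` is left linear. This gives short exact
sequences of `A`-modules `0 → K → B → C → 0` and `0 → C((N+1)d) → B(d) → K → 0`
(`GrMod.exists_sequences`). With `D = (N+1)d`, the twist `C(s + D)` therefore costs at most the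
cells of `C(s)` plus those of `B(s)` and `B(s + d)`. Summing over steps of length `D`, if `B(t + n)`
costs `O(n^e)` cells then `C(t + n)` costs `O(n^(e+1))`: each storey raises the degree by one
(`StMod.Grows.succ`).

There are two exceptions. The first storey is free, since `A` is projective and costs nothing, so
the cost of the twists of `A_1` is bounded (`StMod.grows_one`). The storeys `b_i` are free as well,
since the objects of growth at most `e` form a thick subcategory closed under twists
(`StMod.isThick_grows`). So `A_{ℓ+1} = k` has growth of degree `ℓ - h`, and every module, in
particular `G`, is an iterated extension of twists of `k` (`GrMod.prop_of_trivial`). The same pairs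
of sequences show that finitely many twists of the `A_j` generate (`StMod.exists_generator`).

Three points need care. An extension only controls left multiplication by `x`; passing to right
multiplication uses that the antipode is an involution, which comes from cocommutativity. Cones and
suspensions require projectives to be injective; this holds because the Frobenius property climbs
the tower from `k` to `A`. Finally, cells are counted by `StMod.Built`, where retracts may occur at
any stage, while `StMod.complexity` allows one retract at the end; `StMod.Built.exists_filtered`
reconciles the two.

A generator is not projective because `A ≠ k`, so all complexities are at least `1`. Hence the
categorical entropy is nonnegative and can be dropped from the numerator of the polynomial entropy.
-/

noncomputable section

/-! ### Graded modules: projections, submodules, quotients, products -/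

/-- A criterion for a family of subgroups to be a grading, in terms of projections. -/
theorem DirectSum.isInternal_of_proj {M : Type*} [AddCommGroup M] {𝓜 : ℤ → AddSubgroup M}
    (π : ℤ → M →+ M) (hsame : ∀ n, ∀ m ∈ 𝓜 n, π n m = m)
    (hne : ∀ n j, j ≠ n → ∀ m ∈ 𝓜 j, π n m = 0)
    (hspan : ∀ m : M, m ∈ ⨆ n, 𝓜 n) : DirectSum.IsInternal 𝓜 := by
  have hπ : ∀ (n : ℤ) (z : DirectSum ℤ fun i => 𝓜 i),
      π n (DirectSum.coeAddMonoidHom 𝓜 z) = z n := by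
    intro n z
    induction z using DirectSum.induction_on with
    | zero => simp
    | of i x =>
      rw [DirectSum.coeAddMonoidHom_of]
      by_cases h : i = n
      · subst h
        rw [hsame _ _ x.2, DirectSum.of_eq_same]
      · rw [hne _ _ h _ x.2, DirectSum.of_eq_of_ne _ _ _ (Ne.symm h)]
        rfl
    | add x y hx hy => simp [hx, hy]
  constructor
  · rw [injective_iff_map_eq_zero]
    intro z hz
    ext n
    rw [← hπ, hz]
    simp
  · intro m
    have := hspan m
    have hle : (⨆ n, 𝓜 n) ≤ (DirectSum.coeAddMonoidHom 𝓜).range :=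
      iSup_le fun n x hx => ⟨DirectSum.of (fun i => 𝓜 i) n ⟨x, hx⟩, by simp⟩
    exact hle this

namespace GrMod

variable {k : Type u} [Field k] {A : GrHopf k}

/-- A degree-preserving linear map, as a morphism. -/
def mkHom {X Y : GrMod A} (f : X →ₗ[A] Y) (hf : ∀ (n : ℤ), ∀ x ∈ X.deg n, f x ∈ Y.deg n) : X ⟶ Y :=
  Hom.mk f hf

@[simp] theorem lin_mkHom {X Y : GrMod A} (f : X →ₗ[A] Y) (hf) : lin (mkHom f hf) = f := rfl

@[simp] theorem lin_comp {X Y Z : GrMod A} (f : X ⟶ Y) (g : Y ⟶ Z) :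
    lin (f ≫ g) = lin g ∘ₗ lin f := rfl

@[simp] theorem lin_id (X : GrMod A) : lin (𝟙 X) = LinearMap.id := rfl

theorem hom_ext {X Y : GrMod A} {f g : X ⟶ Y} (h : ∀ x, lin f x = lin g x) : f = g :=
  Hom.ext (LinearMap.ext h)

theorem lin_mem {X Y : GrMod A} (f : X ⟶ Y) {n : ℤ} {x : X} (hx : x ∈ X.deg n) :
    lin f x ∈ Y.deg n := Hom.map_deg f n x hx

/-- The homogeneous components of the elements of a graded module. -/
@[reducible]
def decomp (X : GrMod A) : DirectSum.Decomposition X.deg := X.isInternal.chooseDecomposition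

/-- The projection of a graded module to its part of degree `n`. -/
def proj (X : GrMod A) (n : ℤ) : X →+ X :=
  letI := X.decomp
  (X.deg n).subtype.comp ((DFinsupp.evalAddMonoidHom n).comp
    (DirectSum.decomposeAddEquiv X.deg).toAddMonoidHom)

theorem proj_mem (X : GrMod A) (n : ℤ) (x : X) : X.proj n x ∈ X.deg n := by
  let _ := X.decomp
  exact (DirectSum.decompose X.deg x n).2

theorem proj_same {X : GrMod A} {n : ℤ} {x : X} (hx : x ∈ X.deg n) : X.proj n x = x := by
  let _ := X.decomp
  exact DirectSum.decompose_of_mem_same X.deg hx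

theorem proj_ne {X : GrMod A} {n j : ℤ} {x : X} (hx : x ∈ X.deg j) (h : j ≠ n) :
    X.proj n x = 0 := by
  let _ := X.decomp
  exact DirectSum.decompose_of_mem_ne X.deg hx h

theorem induction_deg {X : GrMod A} {p : X → Prop} (zero : p 0)
    (deg : ∀ n, ∀ x ∈ X.deg n, p x) (add : ∀ x y, p x → p y → p (x + y)) (x : X) : p x := by
  let _ := X.decomp
  exact DirectSum.Decomposition.inductionOn X.deg zero (fun m => deg _ m.1 m.2) add x

theorem eq_zero_of_proj {X : GrMod A} {x : X} (h : ∀ n, X.proj n x = 0) : x = 0 := by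
  let _ := X.decomp
  apply (DirectSum.decompose X.deg).injective
  rw [DirectSum.decompose_zero]
  ext n
  exact h n

theorem lin_proj {X Y : GrMod A} (f : X ⟶ Y) (n : ℤ) (x : X) :
    lin f (X.proj n x) = Y.proj n (lin f x) := by
  induction x using induction_deg with
  | zero => simp
  | deg i x hx =>
    by_cases h : i = n
    · subst h
      rw [proj_same hx, proj_same (lin_mem f hx)]
    · rw [proj_ne hx h, proj_ne (lin_mem f hx) h, map_zero]
  | add x y hx hy => simp [hx, hy]

theorem proj_smul (X : GrMod A) {i : ℤ} {a : A} (ha : a ∈ A.deg i) (n : ℤ) (x : X) :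
    X.proj (i + n) (a • x) = a • X.proj n x := by
  induction x using induction_deg with
  | zero => simp
  | deg j x hx =>
    by_cases h : j = n
    · subst h
      rw [proj_same hx, proj_same (X.smul_deg _ _ _ ha _ hx)]
    · rw [proj_ne hx h, proj_ne (X.smul_deg _ _ _ ha _ hx) (by omega), smul_zero]
  | add x y hx hy => simp [smul_add, hx, hy]

/-- The degree-preserving part of a linear map between graded modules. -/
def degZero {X Y : GrMod A} (f : X →ₗ[A] Y) : X ⟶ Y :=
  letI := X.decomp
  let F : X →+ Y := (DirectSum.toAddMonoid fun n : ℤ =>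
    ((Y.proj n).comp f.toAddMonoidHom).comp (X.deg n).subtype).comp
      (DirectSum.decomposeAddEquiv X.deg).toAddMonoidHom
  have hF : ∀ n, ∀ x ∈ X.deg n, F x = Y.proj n (f x) := by
    intro n x hx
    change DirectSum.toAddMonoid _ (DirectSum.decompose X.deg x) = _
    rw [DirectSum.decompose_of_mem X.deg hx, DirectSum.toAddMonoid_of]
    rfl
  mkHom { F with
    map_smul' := by
      intro a x
      change F (a • x) = a • F x
      induction x using induction_deg with
      | zero => simp
      | deg n x hx =>
        rw [hF n x hx]
        induction a using DirectSum.Decomposition.inductionOn A.deg with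
        | zero => simp
        | homogeneous a =>
          rw [hF _ _ (X.smul_deg _ _ _ a.2 _ hx), map_smul, proj_smul _ a.2]
        | add a b ha hb => rw [add_smul, map_add, ha, hb, add_smul]
      | add x y hx hy => rw [smul_add, map_add, hx, hy, map_add, smul_add] }
    (fun n x hx => by
      change F x ∈ _
      rw [hF n x hx]
      exact proj_mem _ _ _)

theorem degZero_apply {X Y : GrMod A} (f : X →ₗ[A] Y) {n : ℤ} {x : X} (hx : x ∈ X.deg n) :
    lin (degZero f) x = Y.proj n (f x) := by
  let _ := X.decomp
  change DirectSum.toAddMonoid _ (DirectSum.decompose X.deg x) = _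
  rw [DirectSum.decompose_of_mem X.deg hx, DirectSum.toAddMonoid_of]
  rfl

/-- If `v ∘ f ∘ u` preserves degrees, then it agrees with `v ∘ f₀ ∘ u`. -/
theorem degZero_comp {X Y W V : GrMod A} (f : X →ₗ[A] Y) (u : W ⟶ X) (v : Y ⟶ V) (h : W ⟶ V)
    (hf : ∀ w, lin v (f (lin u w)) = lin h w) : u ≫ degZero f ≫ v = h := by
  apply hom_ext
  intro w
  change lin v (lin (degZero f) (lin u w)) = _
  induction w using induction_deg with
  | zero => simp
  | deg n w hw =>
    rw [degZero_apply f (lin_mem u hw), lin_proj, hf, proj_same (lin_mem h hw)]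
  | add x y hx hy => simp [hx, hy]

/-- The direct sum of two graded modules. -/
def prod (X Y : GrMod A) : GrMod A where
  carrier := X × Y
  deg n := (X.deg n).prod (Y.deg n)
  isInternal := by
    apply DirectSum.isInternal_of_proj (fun n => (X.proj n).prodMap (Y.proj n))
    · rintro n ⟨x, y⟩ ⟨hx, hy⟩
      simp [proj_same hx, proj_same hy]
    · rintro n j h ⟨x, y⟩ ⟨hx, hy⟩
      simp [proj_ne hx h, proj_ne hy h]
    · rintro ⟨x, y⟩
      have h1 : ((x, 0) : X × Y) ∈ ⨆ n, (X.deg n).prod (Y.deg n) := by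
        induction x using induction_deg with
        | zero => exact zero_mem _
        | deg n x hx => exact AddSubgroup.mem_iSup_of_mem n ⟨hx, zero_mem _⟩
        | add x y hx hy => simpa using add_mem hx hy
      have h2 : ((0, y) : X × Y) ∈ ⨆ n, (X.deg n).prod (Y.deg n) := by
        induction y using induction_deg with
        | zero => exact zero_mem _
        | deg n x hx => exact AddSubgroup.mem_iSup_of_mem n ⟨zero_mem _, hx⟩
        | add x y hx hy => simpa using add_mem hx hy
      simpa using add_mem h1 h2
  smul_deg i j a ha m hm := ⟨X.smul_deg i j a ha _ hm.1, Y.smul_deg i j a ha _ hm.2⟩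
  finite := by
    have := X.finite
    have := Y.finite
    infer_instance

theorem projective_prod {X Y : GrMod A} (hX : Module.Projective A X) (hY : Module.Projective A Y) :
    Module.Projective A (prod X Y) :=
  inferInstanceAs (Module.Projective A (X × Y))

/-- The first inclusion. -/
def inl (X Y : GrMod A) : X ⟶ prod X Y :=
  mkHom (LinearMap.inl A X Y) fun _ _ hx => ⟨hx, zero_mem _⟩

/-- The second inclusion. -/
def inr (X Y : GrMod A) : Y ⟶ prod X Y :=
  mkHom (LinearMap.inr A X Y) fun _ _ hx => ⟨zero_mem _, hx⟩

/-- The first projection. -/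
def fst (X Y : GrMod A) : prod X Y ⟶ X :=
  mkHom (LinearMap.fst A X Y) fun _ _ hx => hx.1

/-- The second projection. -/
def snd (X Y : GrMod A) : prod X Y ⟶ Y :=
  mkHom (LinearMap.snd A X Y) fun _ _ hx => hx.2

/-- The morphism to a direct sum with given components. -/
def pair {W X Y : GrMod A} (f : W ⟶ X) (g : W ⟶ Y) : W ⟶ prod X Y :=
  mkHom ((lin f).prod (lin g)) fun _ _ hx => ⟨lin_mem f hx, lin_mem g hx⟩

/-- The morphism from a direct sum with given components. -/
def copair {X Y Z : GrMod A} (f : X ⟶ Z) (g : Y ⟶ Z) : prod X Y ⟶ Z :=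
  mkHom ((lin f).coprod (lin g)) fun _ _ hx =>
    add_mem (lin_mem f hx.1) (lin_mem g hx.2)

@[simp] theorem lin_pair {W X Y : GrMod A} (f : W ⟶ X) (g : W ⟶ Y) (w : W) :
    lin (pair f g) w = ((lin f w, lin g w) : X × Y) := rfl
@[simp] theorem lin_copair {X Y Z : GrMod A} (f : X ⟶ Z) (g : Y ⟶ Z) (z : X × Y) :
    lin (copair f g) z = lin f z.1 + lin g z.2 := rfl

/-- A submodule which contains the homogeneous components of its elements. -/
def Homogeneous {X : GrMod A} (N : Submodule A X) : Prop := ∀ n, ∀ x ∈ N, X.proj n x ∈ N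

instance : IsNoetherianRing A :=
  have : IsNoetherian k A := inferInstance
  isNoetherian_of_tower k this

instance : IsArtinianRing A :=
  have : IsArtinian k A := inferInstance
  isArtinian_of_tower k this

instance (X : GrMod A) : Module.Finite A X := X.finite

/-- A homogeneous submodule as a graded module. -/
def sub (X : GrMod A) (N : Submodule A X) (hN : Homogeneous N) : GrMod A where
  carrier := N
  deg n := (X.deg n).comap N.subtype.toAddMonoidHom
  isInternal := by
    have key : ∀ x : X, ∀ hx : x ∈ N, ∀ n, X.proj n x ∈ N := fun x hx n => hN n x hx
    let π : ℤ → N →+ N := fun n => ((X.proj n).comp N.subtype.toAddMonoidHom).codRestrict N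
      (fun x => hN n x x.2)
    apply DirectSum.isInternal_of_proj π
    · intro n m hm
      exact Subtype.ext (proj_same (X := X) hm)
    · intro n j h m hm
      exact Subtype.ext (proj_ne (X := X) hm h)
    · intro m
      let _ := X.decomp
      classical
      have hm : m = ∑ i ∈ (DirectSum.decompose X.deg (m : X)).support, π i m := by
        apply Subtype.ext
        rw [AddSubmonoidClass.coe_finsetSum]
        exact (DirectSum.sum_support_decompose X.deg (m : X)).symm
      rw [hm]
      exact sum_mem fun i _ => AddSubgroup.mem_iSup_of_mem i (proj_mem X i m)
  smul_deg i j a ha m hm := X.smul_deg i j a ha m hm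
  finite := by infer_instance

/-- The inclusion of a homogeneous submodule. -/
def subι (X : GrMod A) (N : Submodule A X) (hN : Homogeneous N) : sub X N hN ⟶ X :=
  mkHom N.subtype fun _ _ hx => hx

/-- The quotient by a homogeneous submodule. -/
def quot (X : GrMod A) (N : Submodule A X) (hN : Homogeneous N) : GrMod A where
  carrier := X ⧸ N
  deg n := (X.deg n).map N.mkQ.toAddMonoidHom
  isInternal := by
    let π : ℤ → (X ⧸ N) →+ (X ⧸ N) := fun n =>
      QuotientAddGroup.map N.toAddSubgroup N.toAddSubgroup (X.proj n) (fun x hx => hN n x hx)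
    have hπ : ∀ n (x : X), π n (N.mkQ x) = N.mkQ (X.proj n x) := fun n x => rfl
    apply DirectSum.isInternal_of_proj π
    · rintro n _ ⟨x, hx, rfl⟩
      exact (hπ n x).trans (by rw [proj_same hx]; rfl)
    · rintro n j h _ ⟨x, hx, rfl⟩
      exact (hπ n x).trans (by rw [proj_ne hx h, map_zero])
    · intro m
      obtain ⟨x, rfl⟩ := N.mkQ_surjective m
      induction x using induction_deg with
      | zero => rw [map_zero]; exact zero_mem _
      | deg n x hx => exact AddSubgroup.mem_iSup_of_mem n ⟨x, hx, rfl⟩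
      | add x y hx hy => rw [map_add]; exact add_mem hx hy
  smul_deg := by
    rintro i j a ha _ ⟨x, hx, rfl⟩
    exact ⟨a • x, X.smul_deg i j a ha x hx, N.mkQ.map_smul a x⟩
  finite := by infer_instance

/-- The projection to a quotient. -/
def quotπ (X : GrMod A) (N : Submodule A X) (hN : Homogeneous N) : X ⟶ quot X N hN :=
  mkHom N.mkQ fun _ x hx => ⟨x, hx, rfl⟩

theorem homogeneous_ker {X Y : GrMod A} (f : X ⟶ Y) : Homogeneous (LinearMap.ker (lin f)) := by
  intro n x hx
  rw [LinearMap.mem_ker] at hx ⊢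
  rw [lin_proj, hx, map_zero]

theorem homogeneous_range {X Y : GrMod A} (f : X ⟶ Y) :
    Homogeneous (LinearMap.range (lin f)) := by
  rintro n _ ⟨x, rfl⟩
  exact ⟨X.proj n x, lin_proj f n x⟩

/-- The kernel of a morphism. -/
abbrev ker {X Y : GrMod A} (f : X ⟶ Y) : GrMod A := sub X _ (homogeneous_ker f)

/-- The inclusion of the kernel. -/
abbrev kerι {X Y : GrMod A} (f : X ⟶ Y) : ker f ⟶ X := subι X _ (homogeneous_ker f)

/-- The cokernel of a morphism. -/
abbrev coker {X Y : GrMod A} (f : X ⟶ Y) : GrMod A := quot Y _ (homogeneous_range f)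

/-- The projection to the cokernel. -/
abbrev cokerπ {X Y : GrMod A} (f : X ⟶ Y) : Y ⟶ coker f := quotπ Y _ (homogeneous_range f)

theorem isShortExact_ker {X Y : GrMod A} (f : X ⟶ Y) (hf : Function.Surjective (lin f)) :
    IsShortExact (kerι f) f := by
  refine ⟨Subtype.val_injective, ?_, hf⟩
  exact LinearMap.exact_subtype_ker_map (lin f)

theorem isShortExact_coker {X Y : GrMod A} (f : X ⟶ Y) (hf : Function.Injective (lin f)) :
    IsShortExact f (cokerπ f) := by
  refine ⟨hf, ?_, Submodule.mkQ_surjective _⟩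
  exact LinearMap.exact_map_mkQ_range (lin f)

theorem isShortExact_prod (X Y : GrMod A) : IsShortExact (inl X Y) (snd X Y) := by
  refine ⟨LinearMap.inl_injective, ?_, LinearMap.snd_surjective⟩
  exact Function.Exact.inl_snd

theorem IsShortExact.twist {X Y Z : GrMod A} {f : X ⟶ Y} {g : Y ⟶ Z} (h : IsShortExact f g)
    (t : ℤ) : IsShortExact ((GrMod.twist A t).map f) ((GrMod.twist A t).map g) := h

/-- Twisting leaves the carrier alone, so this is an equality of objects and can be used for
rewriting. -/
theorem twistObj_twistObj (s t : ℤ) (X : GrMod A) :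
    twistObj s (twistObj t X) = twistObj (s + t) X := by
  have : ∀ n, n - s - t = n - (s + t) := fun n => by ring
  simp only [twistObj, this]

theorem twistObj_zero (X : GrMod A) : twistObj 0 X = X := by
  cases X
  simp only [twistObj, sub_zero]

/-- A module with one element. -/
def zeroMod (A : GrHopf k) : GrMod A where
  carrier := PUnit
  deg _ := ⊤
  isInternal := by
    apply DirectSum.isInternal_of_proj (fun _ => 0)
    · intros; rfl
    · intros; rfl
    · intro m
      exact AddSubgroup.mem_iSup_of_mem 0 trivial
  smul_deg _ _ _ _ _ _ := trivial
  finite := by infer_instance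

instance : Subsingleton (zeroMod A) := inferInstanceAs (Subsingleton PUnit)

theorem projective_zeroMod (A : GrHopf k) : Module.Projective A (zeroMod A) :=
  Module.Projective.of_free

/-- With a congruence, equality of morphisms in the quotient category is the relation itself and not
its closure. Transitivity holds because two factorizations add up to one through the direct sum of
the projectives. -/
instance : Congruence (stableRel A) where
  comp_left := by
    rintro X Y Z f g g' ⟨P, a, b, hP, h⟩
    exact ⟨P, f ≫ a, b, hP, fun x => h _⟩
  comp_right := by
    rintro X Y Z f f' g ⟨P, a, b, hP, h⟩
    refine ⟨P, a, b ≫ g, hP, fun x => ?_⟩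
    have := congrArg (lin g) (h x)
    rwa [map_sub] at this
  equivalence {X Y} := by
    refine ⟨fun f => ?_, ?_, ?_⟩
    · refine ⟨zeroMod A, mkHom 0 fun _ _ _ => trivial, mkHom 0 fun _ _ _ => zero_mem _,
        projective_zeroMod A, fun x => by simp⟩
    · rintro f g ⟨P, a, b, hP, h⟩
      refine ⟨P, a, mkHom (-lin b) (fun n x hx => neg_mem (lin_mem b hx)), hP, fun x => ?_⟩
      rw [lin_mkHom, LinearMap.neg_apply, ← h, neg_sub]
    · rintro f g h ⟨P, a, b, hP, h1⟩ ⟨P', a', b', hP', h2⟩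
      refine ⟨prod P P', pair a a', copair b b', projective_prod hP hP', fun x => ?_⟩
      rw [lin_pair, lin_copair, ← h1, ← h2, sub_add_sub_cancel]

end GrMod

/-! ### Projective and injective graded modules -/

/-- The algebra underlying `A` is a Frobenius algebra: there is a linear functional whose kernel
contains no nonzero left ideal. -/
def GrHopf.IsFrobenius {k : Type u} [Field k] (A : GrHopf k) : Prop :=
  ∃ l : A →ₗ[k] k, ∀ b : A, b ≠ 0 → ∃ a, l (a * b) ≠ 0

namespace GrHopf

variable {k : Type u} [Field k] {A : GrHopf k}

/-- The map `b ↦ l(· b)` from `A` to its dual is injective by the choice of `l`, hence bijective by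
dimension. -/
theorem exists_functional_eq {l : A →ₗ[k] k} (hl : ∀ b : A, b ≠ 0 → ∃ a, l (a * b) ≠ 0)
    (μ : A →ₗ[k] k) : ∃ b, ∀ a, μ a = l (a * b) := by
  let Φ : A →ₗ[k] Module.Dual k A :=
    { toFun := fun b => l ∘ₗ LinearMap.mulRight k b
      map_add' := fun b c => by ext a; simp [mul_add]
      map_smul' := fun c b => by ext a; simp }
  have hinj : Function.Injective Φ := by
    rw [injective_iff_map_eq_zero]
    intro b hb
    by_contra hne
    obtain ⟨a, ha⟩ := hl b hne
    exact ha (LinearMap.congr_fun hb a)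
  obtain ⟨b, hb⟩ := (LinearMap.injective_iff_surjective_of_finrank_eq_finrank
    (Subspace.dual_finrank_eq (K := k) (V := A)).symm).1 hinj μ
  exact ⟨b, fun a => (LinearMap.congr_fun hb a).symm⟩

/-- Baer's criterion: for `f : J → A`, extend `l ∘ f` linearly to `A` and write the extension as
`l(· b)`. Then `l` vanishes on the left ideal generated by `f j - j b`, so `f` is right
multiplication by `b`. -/
theorem IsFrobenius.injective (hA : A.IsFrobenius) : Module.Injective A A := by
  obtain ⟨l, hl⟩ := hA
  apply Module.Baer.injective
  intro J f
  let J' : Submodule k A := J.restrictScalars k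
  let f' : J' →ₗ[k] k := l ∘ₗ (f.restrictScalars k)
  obtain ⟨μ, hμ⟩ := f'.exists_extend
  obtain ⟨b, hb⟩ := exists_functional_eq hl μ
  refine ⟨LinearMap.toSpanSingleton A A b, fun j hj => ?_⟩
  rw [LinearMap.toSpanSingleton_apply, smul_eq_mul]
  by_contra hne
  obtain ⟨a, ha⟩ := hl _ (sub_ne_zero.2 hne)
  apply ha
  have haj : a * j ∈ J := J.mul_mem_left a hj
  have h1 : f' ⟨a * j, haj⟩ = l (a * f ⟨j, hj⟩) := by
    change l (f ⟨a * j, haj⟩) = _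
    rw [← smul_eq_mul a (f _), ← map_smul]
    rfl
  have h2 : f' ⟨a * j, haj⟩ = μ (a * j) := by rw [← hμ]; rfl
  rw [mul_sub, map_sub, ← h1, h2, hb, mul_assoc, sub_self]

theorem IsFrobenius.injective_of_projective (hA : A.IsFrobenius) {P : Type u} [AddCommGroup P]
    [Module A P] [Module.Finite A P] [Module.Projective A P] {X Y : Type u} [AddCommGroup X]
    [Module A X] [AddCommGroup Y] [Module A Y] (f : X →ₗ[A] Y) (hf : Function.Injective f)
    (h : X →ₗ[A] P) : ∃ h' : Y →ₗ[A] P, h' ∘ₗ f = h := by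
  have := hA.injective
  obtain ⟨n, p, hp⟩ := Module.Finite.exists_fin' A P
  obtain ⟨s, hs⟩ := p.exists_rightInverse_of_surjective (LinearMap.range_eq_top.2 hp)
  obtain ⟨g, hg⟩ := Module.Injective.extension_property A (Fin n → A) _ _ f hf (s ∘ₗ h)
  refine ⟨p ∘ₗ g, ?_⟩
  rw [LinearMap.comp_assoc, hg, ← LinearMap.comp_assoc, hs, LinearMap.id_comp]

/-- `A` cogenerates. A functional nonzero at `1` and zero on the annihilator of `x` has the form
`l(· b)`; then `b ≠ 0` is killed by that annihilator, so `x ↦ b` is defined on `A x` and extends to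
`X` by injectivity. -/
theorem IsFrobenius.exists_ne_zero (hA : A.IsFrobenius) {X : Type u} [AddCommGroup X]
    [Module A X] {x : X} (hx : x ≠ 0) : ∃ f : X →ₗ[A] A, f x ≠ 0 := by
  have hinj := hA.injective
  obtain ⟨l, hl⟩ := hA
  let e : A →ₗ[A] X := LinearMap.toSpanSingleton A X x
  have h1 : (1 : A) ∉ (LinearMap.ker e).restrictScalars k := by
    simpa [e] using hx
  obtain ⟨μ, hμ1, hμ⟩ := Submodule.exists_le_ker_of_notMem h1
  obtain ⟨b, hb⟩ := exists_functional_eq hl μ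
  have hker : LinearMap.ker e ≤ LinearMap.ker (LinearMap.toSpanSingleton A A b) := by
    intro j hj
    rw [LinearMap.mem_ker, LinearMap.toSpanSingleton_apply, smul_eq_mul]
    by_contra hne
    obtain ⟨a, ha⟩ := hl _ hne
    rw [← mul_assoc, ← hb] at ha
    exact ha (hμ ((LinearMap.ker e).smul_mem a hj))
  let e' := (LinearMap.ker e).liftQ e le_rfl
  have he' : Function.Injective e' :=
    LinearMap.ker_eq_bot.1 (Submodule.ker_liftQ_eq_bot _ _ _ le_rfl)
  obtain ⟨g, hg⟩ := Module.Injective.extension_property A A _ _ e' he'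
    ((LinearMap.ker e).liftQ (LinearMap.toSpanSingleton A A b) hker)
  refine ⟨g, ?_⟩
  have h2 := LinearMap.congr_fun hg ((LinearMap.ker e).mkQ 1)
  have h3 : g x = b := by simpa [e', e] using h2
  rw [h3]
  rintro rfl
  exact hμ1 (by simp [hb])

end GrHopf

namespace GrMod

variable {k : Type u} [Field k] {A : GrHopf k}

/-- `A` as a module over itself. -/
def regular (A : GrHopf k) : GrMod A where
  carrier := A
  deg n := (A.deg n).toAddSubgroup
  isInternal := DirectSum.Decomposition.isInternal A.deg
  smul_deg _ _ _ ha _ hx := SetLike.GradedMul.mul_mem ha hx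
  finite := by infer_instance

/-- The free module on a generator of degree `t`. -/
abbrev free (A : GrHopf k) (t : ℤ) : GrMod A := twistObj t (regular A)

theorem projective_free (t : ℤ) : Module.Projective A (free A t) :=
  inferInstanceAs (Module.Projective A A)

/-- The degree-preserving part of an ungraded lift is still a lift. This is why projectivity of the
underlying module suffices throughout. -/
theorem exists_lift {P Y Z : GrMod A} (hP : Module.Projective A P) (g : Y ⟶ Z)
    (hg : Function.Surjective (lin g)) (h : P ⟶ Z) : ∃ h' : P ⟶ Y, h' ≫ g = h := by
  obtain ⟨f, hf⟩ := Module.projective_lifting_property (lin g) (lin h) hg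
  exact ⟨degZero f, degZero_comp f (𝟙 P) g h fun w => LinearMap.congr_fun hf w⟩

theorem exists_extend (hA : A.IsFrobenius) {P X Y : GrMod A} (hP : Module.Projective A P)
    (f : X ⟶ Y) (hf : Function.Injective (lin f)) (h : X ⟶ P) : ∃ h' : Y ⟶ P, f ≫ h' = h := by
  obtain ⟨g, hg⟩ := hA.injective_of_projective (lin f) hf (lin h)
  exact ⟨degZero g, degZero_comp g f (𝟙 P) h fun w => LinearMap.congr_fun hg w⟩

/-- The morphism from a free module of rank one determined by a homogeneous element. -/
def ofElement {X : GrMod A} {t : ℤ} {x : X} (hx : x ∈ X.deg t) : free A t ⟶ X :=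
  mkHom (LinearMap.toSpanSingleton A X x) fun n a ha => by
    have := X.smul_deg _ _ a ha _ hx
    rwa [sub_add_cancel] at this

theorem exists_projective_cover (X : GrMod A) :
    ∃ (W P : GrMod A) (f : W ⟶ P) (g : P ⟶ X), IsShortExact f g ∧ Module.Projective A P := by
  suffices h : ∃ (P : GrMod A) (g : P ⟶ X),
      Function.Surjective (lin g) ∧ Module.Projective A P by
    obtain ⟨P, g, hg, hP⟩ := h
    exact ⟨_, P, _, g, isShortExact_ker g hg, hP⟩
  suffices h : ∀ (N : Submodule A X) (P : GrMod A) (g : P ⟶ X), LinearMap.range (lin g) = N →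
      Module.Projective A P → ∃ (P : GrMod A) (g : P ⟶ X),
        Function.Surjective (lin g) ∧ Module.Projective A P by
    exact h _ (free A 0) (ofElement (zero_mem (X.deg 0))) rfl (projective_free 0)
  -- Noetherian induction on the image: as long as a homogeneous element is missed, a free summand
  -- mapping onto it is added.
  intro N
  induction N using WellFoundedGT.induction with
  | ind N ih =>
    intro P g hN hP
    by_cases hg : Function.Surjective (lin g)
    · exact ⟨P, g, hg, hP⟩
    have hx : ∃ (t : ℤ) (x : X), x ∈ X.deg t ∧ x ∉ N := by
      by_contra! hcon
      apply hg
      intro x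
      rw [← LinearMap.mem_range, hN]
      induction x using induction_deg with
      | zero => exact zero_mem _
      | deg n x hx => exact hcon n x hx
      | add x y hx hy => exact add_mem hx hy
    obtain ⟨t, x, hx, hxN⟩ := hx
    refine ih _ ?_ (prod P (free A t)) (copair g (ofElement hx)) rfl
      (projective_prod hP (projective_free t))
    rw [lt_iff_le_not_ge]
    constructor
    · rw [← hN]
      rintro _ ⟨p, rfl⟩
      exact ⟨((p, 0) : P × free A t), by rw [lin_copair]; simp⟩
    · intro hle
      refine hxN (hle ⟨((0, (1 : A)) : P × A), ?_⟩)
      refine (lin_copair (Y := free A t) _ _ _).trans ?_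
      simp only [map_zero, zero_add]
      exact one_smul A x

theorem exists_injective_hull (hA : A.IsFrobenius) (X : GrMod A) :
    ∃ (P W : GrMod A) (f : X ⟶ P) (g : P ⟶ W), IsShortExact f g ∧ Module.Projective A P := by
  suffices h : ∃ (P : GrMod A) (f : X ⟶ P),
      Function.Injective (lin f) ∧ Module.Projective A P by
    obtain ⟨P, f, hf, hP⟩ := h
    exact ⟨P, _, f, _, isShortExact_coker f hf, hP⟩
  suffices h : ∀ (N : Submodule A X) (P : GrMod A) (f : X ⟶ P), LinearMap.ker (lin f) = N →
      Module.Projective A P → ∃ (P : GrMod A) (f : X ⟶ P),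
        Function.Injective (lin f) ∧ Module.Projective A P by
    exact h _ (free A 0) (mkHom 0 fun _ _ _ => zero_mem _) rfl (projective_free 0)
  -- Artinian induction on the kernel: as long as a homogeneous element is killed, a free summand
  -- that detects it is added.
  intro N
  induction N using WellFoundedLT.induction with
  | ind N ih =>
    intro P f hN hP
    by_cases hf : Function.Injective (lin f)
    · exact ⟨P, f, hf, hP⟩
    have hx : ∃ (d : ℤ) (x : X), x ∈ X.deg d ∧ x ∈ N ∧ x ≠ 0 := by
      by_contra! hcon
      apply hf
      rw [injective_iff_map_eq_zero]
      intro x hx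
      refine eq_zero_of_proj fun n => hcon n _ (proj_mem X n x) ?_
      rw [← hN, LinearMap.mem_ker, lin_proj, hx, map_zero]
    obtain ⟨d, x, hx, hxN, hne⟩ := hx
    obtain ⟨φ, hφ⟩ := hA.exists_ne_zero hne
    have hm : ∃ m, (regular A).proj m (φ x) ≠ 0 := by
      by_contra! hcon
      exact hφ (eq_zero_of_proj (X := regular A) hcon)
    obtain ⟨m, hm⟩ := hm
    -- The twist by `d - m` moves the nonzero component of `φ x` from degree `m` to degree `d`, the
    -- degree of `x`, so that it survives in the degree-preserving part.
    let g : X ⟶ free A (d - m) := degZero (Y := free A (d - m)) φ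
    have hg : lin g x ≠ 0 := by
      rw [degZero_apply (Y := free A (d - m)) φ hx]
      have key : ∀ y : A, (free A (d - m)).proj d y = (regular A).proj m y := by
        intro y
        induction y using induction_deg (X := regular A) with
        | zero => exact (map_zero _).trans (map_zero _).symm
        | deg n y hy =>
          by_cases h : n = m
          · subst h
            rw [proj_same hy]
            exact proj_same (X := free A (d - n)) (by
              change y ∈ (regular A).deg (d - (d - n))
              rwa [sub_sub_cancel])
          · rw [proj_ne hy h]
            exact proj_ne (X := free A (d - m)) (j := n + (d - m)) (by
              change y ∈ (regular A).deg (n + (d - m) - (d - m))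
              rwa [add_sub_cancel_right]) (by omega)
        | add x y hx hy => exact (map_add _ x y).trans ((congrArg₂ _ hx hy).trans (map_add _ x y).symm)
      exact fun h0 => hm ((key _).symm.trans h0)
    refine ih _ ?_ (prod P (free A (d - m))) (pair f g) rfl
      (projective_prod hP (projective_free _))
    rw [lt_iff_le_not_ge]
    constructor
    · rw [← hN]
      intro y hy
      exact congrArg Prod.fst hy
    · intro hle
      exact hg (congrArg Prod.snd (hle hxN))

end GrMod

/-! ### Constructions with short exact sequences -/

namespace GrMod

variable {k : Type u} [Field k] {A : GrHopf k}

theorem comp_apply {X Y Z : GrMod A} {f : X ⟶ Y} {g : Y ⟶ Z} {h : X ⟶ Z} (e : f ≫ g = h) (x : X) :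
    lin g (lin f x) = lin h x := by
  rw [← e]
  rfl

instance {X Y : GrMod A} : Zero (X ⟶ Y) := ⟨mkHom 0 fun _ _ _ => zero_mem _⟩
instance {X Y : GrMod A} : Neg (X ⟶ Y) := ⟨fun f => mkHom (-lin f) fun _ _ hx => neg_mem (lin_mem f hx)⟩
instance {X Y : GrMod A} : Sub (X ⟶ Y) :=
  ⟨fun f g => mkHom (lin f - lin g) fun _ _ hx => sub_mem (lin_mem f hx) (lin_mem g hx)⟩

@[simp] theorem lin_zero {X Y : GrMod A} : lin (0 : X ⟶ Y) = 0 := rfl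
@[simp] theorem lin_neg {X Y : GrMod A} (f : X ⟶ Y) : lin (-f) = -lin f := rfl
@[simp] theorem lin_sub {X Y : GrMod A} (f g : X ⟶ Y) : lin (f - g) = lin f - lin g := rfl

namespace IsShortExact

variable {X Y Z : GrMod A} {f : X ⟶ Y} {g : Y ⟶ Z}

theorem inj (h : IsShortExact f g) {x : X} (hx : lin f x = 0) : x = 0 :=
  (injective_iff_map_eq_zero _).1 h.1 x hx

theorem surj (h : IsShortExact f g) (z : Z) : ∃ y, lin g y = z := h.2.2 z

theorem zero (h : IsShortExact f g) (x : X) : lin g (lin f x) = 0 := h.2.1.apply_apply_eq_zero x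

theorem exact (h : IsShortExact f g) {y : Y} (hy : lin g y = 0) : ∃ x, lin f x = y := (h.2.1 y).1 hy

theorem mk (h1 : ∀ x, lin f x = 0 → x = 0) (h2 : ∀ x, lin g (lin f x) = 0)
    (h3 : ∀ y, lin g y = 0 → ∃ x, lin f x = y) (h4 : ∀ z, ∃ y, lin g y = z) : IsShortExact f g :=
  ⟨(injective_iff_map_eq_zero _).2 h1, fun y => ⟨h3 y, by rintro ⟨x, rfl⟩; exact h2 x⟩, h4⟩

theorem exists_lift (h : IsShortExact f g) {V : GrMod A} (a : V ⟶ Y)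
    (ha : ∀ v, lin g (lin a v) = 0) : ∃ b : V ⟶ X, b ≫ f = a := by
  let e := LinearEquiv.ofInjective (lin f) h.1
  have hr : ∀ v, lin a v ∈ LinearMap.range (lin f) := fun v => h.exact (ha v)
  let b : V →ₗ[A] X := e.symm.toLinearMap ∘ₗ (lin a).codRestrict _ hr
  refine ⟨degZero b, degZero_comp b (𝟙 V) f a fun v => ?_⟩
  change lin f (e.symm ⟨lin a v, hr v⟩) = lin a v
  exact congrArg Subtype.val (e.apply_symm_apply ⟨lin a v, hr v⟩)

theorem exists_desc (h : IsShortExact f g) {V : GrMod A} (a : Y ⟶ V)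
    (ha : ∀ x, lin a (lin f x) = 0) : ∃ b : Z ⟶ V, g ≫ b = a := by
  have hk : LinearMap.ker (lin g) ≤ LinearMap.ker (lin a) := by
    intro y hy
    obtain ⟨x, rfl⟩ := h.exact hy
    exact ha x
  let b : Z →ₗ[A] V := (LinearMap.ker (lin g)).liftQ (lin a) hk ∘ₗ
    ((lin g).quotKerEquivOfSurjective h.2.2).symm.toLinearMap
  refine ⟨degZero b, degZero_comp b g (𝟙 V) a fun y => ?_⟩
  have : ((lin g).quotKerEquivOfSurjective h.2.2).symm (lin g y) =
      (LinearMap.ker (lin g)).mkQ y := by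
    rw [LinearEquiv.symm_apply_eq]
    rfl
  change (LinearMap.ker (lin g)).liftQ (lin a) hk
    (((lin g).quotKerEquivOfSurjective h.2.2).symm (lin g y)) = lin a y
  rw [this]
  rfl

theorem projective_retract {X Y : GrMod A} (s : X ⟶ Y) (r : Y ⟶ X) (h : s ≫ r = 𝟙 X)
    (hY : Module.Projective A Y) : Module.Projective A X :=
  Module.Projective.of_split (lin s) (lin r) (by rw [← lin_comp, h, lin_id])

/-- A short exact sequence whose quotient is projective splits. -/
theorem exists_split (h : IsShortExact f g) (hZ : Module.Projective A Z) :
    ∃ (s : Z ⟶ Y) (r : Y ⟶ X), s ≫ g = 𝟙 Z ∧ f ≫ r = 𝟙 X ∧ IsShortExact s r := by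
  obtain ⟨s, hs⟩ := GrMod.exists_lift hZ g h.2.2 (𝟙 Z)
  have hs' : ∀ z, lin g (lin s z) = z := comp_apply hs
  obtain ⟨r, hr⟩ := h.exists_lift (𝟙 Y - g ≫ s) (fun y => by simp [hs'])
  have hr' : ∀ y, lin f (lin r y) = y - lin s (lin g y) := comp_apply hr
  have hfr : ∀ x, lin r (lin f x) = x := fun x => h.1 (by rw [hr', h.zero]; simp)
  refine ⟨s, r, hs, hom_ext hfr, .mk ?_ ?_ ?_ fun x => ⟨_, hfr x⟩⟩
  · intro z hz
    rw [← hs' z, hz, map_zero]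
  · intro z
    apply h.inj
    rw [hr', hs', sub_self]
  · intro y hy
    refine ⟨lin g y, ?_⟩
    have := hr' y
    rw [hy, map_zero] at this
    exact (sub_eq_zero.1 this.symm).symm

theorem projective_middle (h : IsShortExact f g) (hX : Module.Projective A X)
    (hZ : Module.Projective A Z) : Module.Projective A Y := by
  obtain ⟨s, r, hs, hr, h'⟩ := h.exists_split hZ
  have hs' : ∀ z, lin g (lin s z) = z := comp_apply hs
  have hr' : ∀ x, lin r (lin f x) = x := comp_apply hr
  refine projective_retract (pair r g) (copair f s) (hom_ext fun y => ?_) (projective_prod hX hZ)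
  change lin f (lin r y) + lin s (lin g y) = y
  obtain ⟨x, hx⟩ := h.exact (y := y - lin s (lin g y)) (by rw [map_sub, hs', sub_self])
  have : lin r y = x := by
    rw [← hr' x, hx, map_sub, h'.zero, sub_zero]
  rw [this, hx, sub_add_cancel]

theorem projective_left (h : IsShortExact f g) (hY : Module.Projective A Y)
    (hZ : Module.Projective A Z) : Module.Projective A X := by
  obtain ⟨s, r, -, hr, -⟩ := h.exists_split hZ
  exact projective_retract f r hr hY

/-- Over a Frobenius algebra the projective submodule is injective, so the sequence splits. -/
theorem projective_right (hA : A.IsFrobenius) (h : IsShortExact f g) (hX : Module.Projective A X)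
    (hY : Module.Projective A Y) : Module.Projective A Z := by
  obtain ⟨r, hr⟩ := exists_extend hA hX f h.1 (𝟙 X)
  have hr' : ∀ x, lin r (lin f x) = x := comp_apply hr
  obtain ⟨s, hs⟩ := h.exists_desc (𝟙 Y - r ≫ f) (fun x => by simp [hr'])
  have hs' : ∀ y, lin s (lin g y) = y - lin f (lin r y) := comp_apply hs
  refine projective_retract s g (hom_ext fun z => ?_) hY
  obtain ⟨y, rfl⟩ := h.surj z
  change lin g (lin s (lin g y)) = _
  rw [hs', map_sub, h.zero, sub_zero]
  rfl

/-- The product of two short exact sequences. -/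
theorem prod (h : IsShortExact f g) {X' Y' Z' : GrMod A} {f' : X' ⟶ Y'} {g' : Y' ⟶ Z'}
    (h' : IsShortExact f' g') : IsShortExact (pair (fst X X' ≫ f) (snd X X' ≫ f'))
      (pair (fst Y Y' ≫ g) (snd Y Y' ≫ g')) := by
  refine .mk ?_ ?_ ?_ ?_
  · rintro ⟨x, x'⟩ hx
    exact Prod.ext (h.inj (congrArg Prod.fst hx)) (h'.inj (congrArg Prod.snd hx))
  · rintro ⟨x, x'⟩
    exact Prod.ext (h.zero x) (h'.zero x')
  · rintro ⟨y, y'⟩ hy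
    obtain ⟨x, hx⟩ := h.exact (congrArg Prod.fst hy)
    obtain ⟨x', hx'⟩ := h'.exact (congrArg Prod.snd hy)
    exact ⟨(x, x'), Prod.ext hx hx'⟩
  · rintro ⟨z, z'⟩
    obtain ⟨y, hy⟩ := h.surj z
    obtain ⟨y', hy'⟩ := h'.surj z'
    exact ⟨(y, y'), Prod.ext hy hy'⟩

theorem comp_bijective (h : IsShortExact f g) {Z' : GrMod A} (e : Z ⟶ Z')
    (he : Function.Bijective (lin e)) : IsShortExact f (g ≫ e) := by
  refine .mk (fun x => h.inj) (fun x => ?_) (fun y hy => ?_) (fun z => ?_)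
  · change lin e (lin g (lin f x)) = 0
    rw [h.zero, map_zero]
  · exact h.exact ((injective_iff_map_eq_zero _).1 he.1 _ hy)
  · obtain ⟨z', rfl⟩ := he.2 z
    obtain ⟨y, rfl⟩ := h.surj z'
    exact ⟨y, rfl⟩

theorem bijective_comp (h : IsShortExact f g) {X' : GrMod A} (e : X' ⟶ X)
    (he : Function.Bijective (lin e)) : IsShortExact (e ≫ f) g := by
  refine .mk (fun x hx => ?_) (fun x => h.zero _) (fun y hy => ?_) h.surj
  · exact (injective_iff_map_eq_zero _).1 he.1 _ (h.inj hx)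
  · obtain ⟨x, rfl⟩ := h.exact hy
    obtain ⟨x', rfl⟩ := he.2 x
    exact ⟨x', rfl⟩

/-- The preimage of a submodule `X` of `Y` under an extension `P` of `Y` by `W`. -/
theorem exists_pullback (h : IsShortExact f g) {W P : GrMod A} {i : W ⟶ P} {p : P ⟶ Y}
    (hp : IsShortExact i p) : ∃ (V : GrMod A) (a : W ⟶ V) (b : V ⟶ X) (c : V ⟶ P),
      IsShortExact a b ∧ IsShortExact c (p ≫ g) := by
  have hc := isShortExact_ker (p ≫ g) (h.2.2.comp hp.2.2)
  obtain ⟨b, hb⟩ := h.exists_lift (kerι (p ≫ g) ≫ p) (fun v => hc.zero v)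
  have hb' : ∀ v, lin f (lin b v) = lin p (lin (kerι (p ≫ g)) v) := comp_apply hb
  obtain ⟨a, ha⟩ := hc.exists_lift i (fun w => by
    change lin g (lin p (lin i w)) = 0
    rw [hp.zero, map_zero])
  have ha' : ∀ w, lin (kerι (p ≫ g)) (lin a w) = lin i w := comp_apply ha
  refine ⟨_, a, b, _, .mk ?_ ?_ ?_ ?_, hc⟩
  · intro w hw
    apply hp.inj
    rw [← ha', hw, map_zero]
  · intro w
    apply h.inj
    rw [hb', ha', hp.zero]
  · intro v hv
    obtain ⟨w, hw⟩ := hp.exact (y := lin (kerι (p ≫ g)) v) (by rw [← hb', hv, map_zero])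
    refine ⟨w, hc.1 ?_⟩
    rw [ha', hw]
  · intro x
    obtain ⟨y, hy⟩ := hp.surj (lin f x)
    obtain ⟨v, rfl⟩ := hc.exact (y := y) (by
      change lin g (lin p y) = 0
      rw [hy, h.zero])
    exact ⟨v, h.1 (by rw [hb', hy])⟩

/-- The dual of `exists_pullback`. -/
theorem exists_pushout (h : IsShortExact f g) {P W : GrMod A} {i : Y ⟶ P} {p : P ⟶ W}
    (hp : IsShortExact i p) : ∃ (V : GrMod A) (c : P ⟶ V) (a : Z ⟶ V) (b : V ⟶ W),
      IsShortExact (f ≫ i) c ∧ IsShortExact a b := by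
  have hc := isShortExact_coker (f ≫ i) (hp.1.comp h.1)
  set c := cokerπ (f ≫ i)
  obtain ⟨b, hb⟩ := hc.exists_desc p (fun x => hp.zero _)
  have hb' : ∀ y, lin b (lin c y) = lin p y := comp_apply hb
  obtain ⟨a, ha⟩ := h.exists_desc (i ≫ c) (fun x => hc.zero x)
  have ha' : ∀ y, lin a (lin g y) = lin c (lin i y) := comp_apply ha
  refine ⟨_, c, a, b, hc, .mk ?_ ?_ ?_ ?_⟩
  · intro z hz
    obtain ⟨y, rfl⟩ := h.surj z
    rw [ha'] at hz
    obtain ⟨x, hx⟩ := hc.exact hz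
    rw [← hp.1 hx]
    exact h.zero x
  · intro z
    obtain ⟨y, rfl⟩ := h.surj z
    rw [ha', hb', hp.zero]
  · intro v hv
    obtain ⟨y, rfl⟩ := hc.surj v
    rw [hb'] at hv
    obtain ⟨y', rfl⟩ := hp.exact hv
    exact ⟨lin g y', ha' y'⟩
  · intro w
    obtain ⟨y, rfl⟩ := hp.surj w
    exact ⟨lin c y, hb' y⟩

/-- Rotation of a short exact sequence to the left. -/
theorem exists_rotate_left (h : IsShortExact f g) {K P : GrMod A} {j : K ⟶ P} {p : P ⟶ Z}
    (hp : IsShortExact j p) (hP : Module.Projective A P) :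
    ∃ (a : K ⟶ GrMod.prod X P) (b : GrMod.prod X P ⟶ Y), IsShortExact a b := by
  obtain ⟨c, hc⟩ := GrMod.exists_lift hP g h.2.2 p
  have hc' : ∀ x, lin g (lin c x) = lin p x := comp_apply hc
  obtain ⟨w, hw⟩ := h.exists_lift (j ≫ c) (fun x => by
    change lin g (lin c (lin j x)) = 0
    rw [hc', hp.zero])
  have hw' : ∀ x, lin f (lin w x) = lin c (lin j x) := comp_apply hw
  refine ⟨pair (-w) j, copair f c, .mk ?_ ?_ ?_ ?_⟩
  · intro x hx
    exact hp.inj (congrArg Prod.snd hx)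
  · intro x
    change lin f (-(lin w x)) + lin c (lin j x) = 0
    rw [map_neg, hw', neg_add_cancel]
  · rintro ⟨x, q⟩ hxq
    change lin f x + lin c q = 0 at hxq
    obtain ⟨κ, rfl⟩ := hp.exact (y := q) (by
      have := congrArg (lin g) hxq
      rwa [map_add, h.zero, zero_add, hc', map_zero] at this)
    refine ⟨κ, Prod.ext (h.1 ?_) rfl⟩
    change lin f (-(lin w κ)) = lin f x
    rw [map_neg, hw', eq_comm]
    exact eq_neg_of_add_eq_zero_left hxq
  · intro y
    obtain ⟨q, hq⟩ := hp.surj (lin g y)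
    obtain ⟨x, hx⟩ := h.exact (y := y - lin c q) (by rw [map_sub, hc', hq, sub_self])
    refine ⟨(x, q), ?_⟩
    change lin f x + lin c q = y
    rw [hx, sub_add_cancel]

/-- Rotation of a short exact sequence to the right. -/
theorem exists_rotate_right (hA : A.IsFrobenius) (h : IsShortExact f g) {P K : GrMod A} {j : X ⟶ P}
    {p : P ⟶ K} (hp : IsShortExact j p) (hP : Module.Projective A P) :
    ∃ (a : Y ⟶ GrMod.prod Z P) (b : GrMod.prod Z P ⟶ K), IsShortExact a b := by
  obtain ⟨c, hc⟩ := exists_extend hA hP f h.1 j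
  have hc' : ∀ x, lin c (lin f x) = lin j x := comp_apply hc
  obtain ⟨w, hw⟩ := h.exists_desc (c ≫ p) (fun x => by
    change lin p (lin c (lin f x)) = 0
    rw [hc', hp.zero])
  have hw' : ∀ y, lin w (lin g y) = lin p (lin c y) := comp_apply hw
  refine ⟨pair g c, copair (-w) p, .mk ?_ ?_ ?_ ?_⟩
  · intro y hy
    obtain ⟨x, rfl⟩ := h.exact (congrArg Prod.fst hy)
    have h2 : lin c (lin f x) = 0 := congrArg Prod.snd hy
    rw [hc'] at h2
    rw [hp.inj h2, map_zero]
  · intro y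
    change -(lin w (lin g y)) + lin p (lin c y) = 0
    rw [hw', neg_add_cancel]
  · rintro ⟨z, q⟩ hzq
    change -(lin w z) + lin p q = 0 at hzq
    obtain ⟨y, rfl⟩ := h.surj z
    rw [hw'] at hzq
    obtain ⟨x, hx⟩ := hp.exact (y := q - lin c y) (by
      rw [map_sub, sub_eq_add_neg, add_comm]
      exact hzq)
    refine ⟨y + lin f x, Prod.ext ?_ ?_⟩
    · change lin g (y + lin f x) = lin g y
      rw [map_add, h.zero, add_zero]
    · change lin c (y + lin f x) = q
      rw [map_add, hc', hx, add_sub_cancel]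
  · intro z
    obtain ⟨q, rfl⟩ := hp.surj z
    refine ⟨(0, q), ?_⟩
    change -(lin w 0) + lin p q = lin p q
    rw [map_zero, neg_zero, zero_add]

end IsShortExact

/-! ### Complements of retracts. -/

section Retract

variable {X Y : GrMod A} {s : X ⟶ Y} {r : Y ⟶ X}

/-- The complementary projection of a retract. -/
theorem exists_complement (h : s ≫ r = 𝟙 X) : ∃ c : Y ⟶ ker r,
    ∀ y, lin (kerι r) (lin c y) = y - lin s (lin r y) := by
  have h' : ∀ x, lin r (lin s x) = x := comp_apply h
  have hr := isShortExact_ker r fun x => ⟨_, h' x⟩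
  obtain ⟨c, hc⟩ := hr.exists_lift (𝟙 Y - r ≫ s) (fun y => by simp [h'])
  exact ⟨c, comp_apply hc⟩

theorem bijective_copair (h : s ≫ r = 𝟙 X) :
    Function.Bijective (lin (copair s (kerι r))) := by
  have h' : ∀ x, lin r (lin s x) = x := comp_apply h
  obtain ⟨c, hc⟩ := exists_complement h
  constructor
  · rw [injective_iff_map_eq_zero]
    rintro ⟨x, y⟩ hxy
    change lin s x + lin (kerι r) y = 0 at hxy
    have h0 : lin r (lin (kerι r) y) = 0 := y.2
    have hx : x = 0 := by
      have := congrArg (lin r) hxy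
      rwa [map_add, h0, add_zero, h', map_zero] at this
    rw [hx, map_zero, zero_add] at hxy
    exact Prod.ext hx (Subtype.ext hxy)
  · intro y
    refine ⟨(lin r y, lin c y), ?_⟩
    change lin s (lin r y) + lin (kerι r) (lin c y) = y
    rw [hc, add_sub_cancel]

theorem bijective_pair (h : s ≫ r = 𝟙 X) {c : Y ⟶ ker r}
    (hc : ∀ y, lin (kerι r) (lin c y) = y - lin s (lin r y)) :
    Function.Bijective (lin (pair r c)) := by
  have h' : ∀ x, lin r (lin s x) = x := comp_apply h
  constructor
  · rw [injective_iff_map_eq_zero]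
    intro y hy
    have h1 : lin r y = 0 := congrArg Prod.fst hy
    have h2 : lin c y = 0 := congrArg Prod.snd hy
    have := hc y
    rw [h1, h2, map_zero, map_zero, sub_zero] at this
    exact this.symm
  · rintro ⟨x, y⟩
    have h0 : lin r (lin (kerι r) y) = 0 := y.2
    have h1 : lin r (lin s x + lin (kerι r) y) = x := by rw [map_add, h', h0, add_zero]
    refine ⟨lin s x + lin (kerι r) y, Prod.ext h1 (Subtype.ext ?_)⟩
    refine (hc _).trans ?_
    rw [h1, add_sub_cancel_left]
    rfl

end Retract

end GrMod

/-! ### The number of cells of a module -/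

namespace StMod

open GrMod

variable {k : Type u} [Field k] {A : GrHopf k}

theorem map_eq_iff {X Y : GrMod A} (f g : X ⟶ Y) :
    (Q A).map f = (Q A).map g ↔ GrMod.stableRel A f g :=
  CategoryTheory.Quotient.functor_map_eq_iff (GrMod.stableRel A) f g

theorem isZero_of_projective {X : GrMod A} (hX : Module.Projective A X) : IsZero ((Q A).obj X) := by
  constructor
  · rintro ⟨Y⟩
    refine ⟨⟨⟨(Q A).map 0⟩, fun f => ?_⟩⟩
    obtain ⟨f, rfl⟩ := (Q A).map_surjective f
    exact (map_eq_iff f 0).2 ⟨X, 𝟙 X, f, hX, fun x => by simp⟩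
  · rintro ⟨Y⟩
    refine ⟨⟨⟨(Q A).map 0⟩, fun f => ?_⟩⟩
    obtain ⟨f, rfl⟩ := (Q A).map_surjective f
    exact (map_eq_iff f 0).2 ⟨X, f, 𝟙 X, hX, fun x => by simp⟩

/-- A retract in the stable category is a direct summand up to a projective summand. -/
theorem exists_retract {X Y : GrMod A} (h : Retract ((Q A).obj X) ((Q A).obj Y)) :
    ∃ (P : GrMod A) (s : X ⟶ prod Y P) (r : prod Y P ⟶ X), Module.Projective A P ∧ s ≫ r = 𝟙 X := by
  obtain ⟨s, hs⟩ := (Q A).map_surjective h.i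
  obtain ⟨r, hr⟩ := (Q A).map_surjective h.r
  have := h.retract
  rw [← hs, ← hr, ← (Q A).map_comp, ← (Q A).map_id] at this
  obtain ⟨P, a, b, hP, hab⟩ := (map_eq_iff _ _).1 this
  refine ⟨P, pair s a, copair r (-b), hP, hom_ext fun x => ?_⟩
  have h1 := hab x
  change lin r (lin s x) - x = lin b (lin a x) at h1
  change lin r (lin s x) + -(lin b (lin a x)) = x
  rw [← h1, neg_sub, add_sub_cancel]

theorem projective_of_retract {X Y : GrMod A} (h : Retract ((Q A).obj X) ((Q A).obj Y))
    (hY : Module.Projective A Y) : Module.Projective A X := by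
  obtain ⟨P, s, r, hP, hsr⟩ := exists_retract h
  exact IsShortExact.projective_retract s r hsr (projective_prod hY hP)

theorem retract_zeroMod {X : StMod A} (hX : IsZero X) :
    Nonempty (Retract X ((Q A).obj (zeroMod A))) :=
  let e := hX.iso (isZero_of_projective (projective_zeroMod A))
  ⟨⟨e.hom, e.inv, e.hom_inv_id⟩⟩

theorem IsCofiberSeq.of_isShortExact {X Y Z : GrMod A} {f : X ⟶ Y} {g : Y ⟶ Z}
    (h : IsShortExact f g) : IsCofiberSeq ((Q A).map f) ((Q A).map g) :=
  ⟨X, Y, Z, f, g, h, Iso.refl _, Iso.refl _, Iso.refl _, by simp, by simp⟩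

theorem isSuspension_of_isShortExact {X P Y : GrMod A} {f : X ⟶ P} {g : P ⟶ Y}
    (h : IsShortExact f g) (hP : Module.Projective A P) :
    IsSuspension ((Q A).obj X) ((Q A).obj Y) :=
  ⟨_, _, _, isZero_of_projective hP, .of_isShortExact h⟩

/-- `Built G m Y` means that `Y` can be constructed from `m` shifts of `G` by extensions and
retracts. -/
inductive Built (G : StMod A) : ℕ → GrMod A → Prop
  | proj {Y : GrMod A} : Module.Projective A Y → Built G 0 Y
  | shift {Z : GrMod A} {n : ℤ} : IsShift G n ((Q A).obj Z) → Built G 1 Z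
  | ext {X Y Z : GrMod A} {m n : ℕ} {f : X ⟶ Y} {g : Y ⟶ Z} : IsShortExact f g →
      Built G m X → Built G n Z → Built G (m + n) Y
  | retract {X Y : GrMod A} {m : ℕ} {s : X ⟶ Y} {r : Y ⟶ X} : s ≫ r = 𝟙 X →
      Built G m Y → Built G m X

variable {G : StMod A} {m n : ℕ}

theorem inl_fst (X Y : GrMod A) : (inl X Y : X ⟶ prod X Y) ≫ fst X Y = 𝟙 X := rfl

theorem Built.prod_proj {Y P : GrMod A} (h : Built G m Y) (hP : Module.Projective A P) :
    Built G m (prod Y P) :=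
  .ext (isShortExact_prod Y P) h (.proj hP)

/-- Shifts of `G` desuspend to shifts of `G`, so the number of cells does not change. All
presentations are quantified inside the induction because it needs other covers than the given one.
-/
theorem Built.desuspend {Z : GrMod A} (h : Built G m Z) : ∀ {W P : GrMod A} {f : W ⟶ P} {g : P ⟶ Z},
    IsShortExact f g → Module.Projective A P → Built G m W := by
  induction h with
  | proj hY =>
    intro W P f g h hP
    exact .proj (h.projective_left hP hY)
  | shift hs =>
    intro W P f g h hP
    exact .shift (.desuspension hs (isSuspension_of_isShortExact h hP))
  | ext hfg _ _ ihX ihZ =>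
    intro W P f g h hP
    -- `V` desuspends the quotient and `W` is the kernel of a map from `V` onto the submodule. One
    -- rotation exhibits `W ⊕ P'` as an extension of `V` by a desuspension `K` of the submodule.
    obtain ⟨V, a, b, c, hab, hc⟩ := hfg.exists_pullback h
    obtain ⟨K, P', j, p, hp, hP'⟩ := exists_projective_cover (A := A) _
    obtain ⟨a', b', hab'⟩ := hab.exists_rotate_left hp hP'
    exact .retract (inl_fst _ _) (.ext hab' (ihX hp hP') (ihZ hc hP))
  | @retract X Y m s r hsr _ ih =>
    intro W P f g h hP
    -- Adding a cover of the complement turns the presentation of the summand into one of the whole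
    -- of `Y`.
    obtain ⟨K, P', j, p, hp, hP'⟩ := exists_projective_cover (ker r)
    exact .retract (inl_fst _ _)
      (ih ((h.prod hp).comp_bijective _ (bijective_copair hsr)) (projective_prod hP hP'))

theorem Built.suspend (hA : A.IsFrobenius) {Z : GrMod A} (h : Built G m Z) :
    ∀ {W P : GrMod A} {f : Z ⟶ P} {g : P ⟶ W},
      IsShortExact f g → Module.Projective A P → Built G m W := by
  induction h with
  | proj hY =>
    intro W P f g h hP
    exact .proj (h.projective_right hA hY hP)
  | shift hs =>
    intro W P f g h hP
    exact .shift (.suspension hs (isSuspension_of_isShortExact h hP))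
  | ext hfg _ _ ihX ihZ =>
    intro W P f g h hP
    obtain ⟨V, c, a, b, hc, hab⟩ := hfg.exists_pushout h
    obtain ⟨P', K, j, p, hp, hP'⟩ := exists_injective_hull hA _
    obtain ⟨a', b', hab'⟩ := hab.exists_rotate_right hA hp hP'
    exact .retract (inl_fst _ _) (.ext hab' (ihX hc hP) (ihZ hp hP'))
  | @retract X Y m s r hsr _ ih =>
    intro W P f g h hP
    obtain ⟨P', K, j, p, hp, hP'⟩ := exists_injective_hull hA (ker r)
    obtain ⟨c, hc⟩ := exists_complement hsr
    exact .retract (inl_fst _ _)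
      (ih ((h.prod hp).bijective_comp _ (bijective_pair hsr hc)) (projective_prod hP hP'))

/-- By rotation, `X ⊕ P` is an extension of `Y` by a desuspension of `Z`. -/
theorem Built.left {X Y Z : GrMod A} {f : X ⟶ Y} {g : Y ⟶ Z} (h : IsShortExact f g)
    (hY : Built G m Y) (hZ : Built G n Z) : Built G (n + m) X := by
  obtain ⟨K, P, j, p, hp, hP⟩ := exists_projective_cover Z
  obtain ⟨a, b, hab⟩ := h.exists_rotate_left hp hP
  exact .retract (inl_fst _ _) (.ext hab (hZ.desuspend hp hP) hY)

theorem Built.right (hA : A.IsFrobenius) {X Y Z : GrMod A} {f : X ⟶ Y} {g : Y ⟶ Z}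
    (h : IsShortExact f g) (hX : Built G m X) (hY : Built G n Y) : Built G (n + m) Z := by
  obtain ⟨P, K, j, p, hp, hP⟩ := exists_injective_hull hA X
  obtain ⟨a, b, hab⟩ := h.exists_rotate_right hA hp hP
  exact .retract (inl_fst _ _) (.ext hab hY (hX.suspend hA hp hP))

theorem Built.of_retract {X Y : StMod A} (h : Retract X Y) (hY : Built G m Y.as) :
    Built G m X.as := by
  obtain ⟨P, s, r, hP, hsr⟩ := exists_retract (X := X.as) (Y := Y.as) h
  exact .retract hsr (hY.prod_proj hP)

theorem Built.of_iso {X Y : StMod A} (e : X ≅ Y) (hY : Built G m Y.as) : Built G m X.as :=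
  hY.of_retract ⟨e.hom, e.inv, e.hom_inv_id⟩

theorem IsCofiberSeq.built_left {X Y Z : StMod A} {f : X ⟶ Y} {g : Y ⟶ Z} (h : IsCofiberSeq f g)
    (hY : Built G m Y.as) (hZ : Built G n Z.as) : Built G (n + m) X.as := by
  obtain ⟨X', Y', Z', i, p, hip, a, b, c, -, -⟩ := h
  exact .of_iso a (Built.left hip (hY.of_iso b.symm) (hZ.of_iso c.symm))

theorem IsCofiberSeq.built_middle {X Y Z : StMod A} {f : X ⟶ Y} {g : Y ⟶ Z}
    (h : IsCofiberSeq f g) (hX : Built G m X.as) (hZ : Built G n Z.as) :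
    Built G (m + n) Y.as := by
  obtain ⟨X', Y', Z', i, p, hip, a, b, c, -, -⟩ := h
  exact .of_iso b (Built.ext hip (hX.of_iso a.symm) (hZ.of_iso c.symm))

theorem IsCofiberSeq.built_right (hA : A.IsFrobenius) {X Y Z : StMod A} {f : X ⟶ Y} {g : Y ⟶ Z}
    (h : IsCofiberSeq f g) (hX : Built G m X.as) (hY : Built G n Y.as) :
    Built G (n + m) Z.as := by
  obtain ⟨X', Y', Z', i, p, hip, a, b, c, -, -⟩ := h
  exact .of_iso c (Built.right hA hip (hX.of_iso a.symm) (hY.of_iso b.symm))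

/-! ### Filtrations -/

/-- `Y` has a filtration with `n` steps, all whose subquotients are shifts of `G`, which starts
with a projective module. -/
inductive Filtered (G : StMod A) : ℕ → GrMod A → Prop
  | zero {Y : GrMod A} : Module.Projective A Y → Filtered G 0 Y
  | succ {X Y Z : GrMod A} {n : ℕ} {N : ℤ} {f : X ⟶ Y} {g : Y ⟶ Z} : IsShortExact f g →
      Filtered G n X → IsShift G N ((Q A).obj Z) → Filtered G (n + 1) Y

theorem Filtered.ext_projective {Z : GrMod A} (h : Filtered G n Z) :
    ∀ {P Y : GrMod A} {f : P ⟶ Y} {g : Y ⟶ Z}, IsShortExact f g → Module.Projective A P →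
      Filtered G n Y := by
  induction h with
  | zero hZ =>
    intro P Y f g h hP
    exact .zero (h.projective_middle hP hZ)
  | succ hfg _ hs ih =>
    intro P Y f g h hP
    obtain ⟨V, a, b, c, hab, hc⟩ := hfg.exists_pullback h
    exact .succ hc (ih hab hP) hs

/-- The filtration of `Z` is pulled back to `Y` and placed on top of that of `X`. Its projective
bottom term splits off and is moved below `X`. -/
theorem Filtered.ext {X Z : GrMod A} (hX : Filtered G m X) (h : Filtered G n Z) :
    ∀ {Y : GrMod A} {f : X ⟶ Y} {g : Y ⟶ Z}, IsShortExact f g → Filtered G (m + n) Y := by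
  induction h with
  | zero hZ =>
    intro Y f g h
    obtain ⟨s, r, -, -, h'⟩ := h.exists_split hZ
    exact hX.ext_projective h' hZ
  | succ hfg _ hs ih =>
    intro Y f g h
    obtain ⟨V, a, b, c, hab, hc⟩ := hfg.exists_pullback h
    exact .succ hc (ih hab) hs

/-- All retracts can be postponed to the end. An extension of `Z` by `X` becomes, after adding the
complements `ker r` and `ker r'` to the middle term, an extension of `Z' ≅ Z ⊕ ker r'` by `X' ≅ X ⊕
ker r`. -/
theorem Built.exists_filtered {Y : GrMod A} (h : Built G m Y) :
    ∃ (Y' : GrMod A) (s : Y ⟶ Y') (r : Y' ⟶ Y), s ≫ r = 𝟙 Y ∧ Filtered G m Y' := by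
  induction h with
  | @proj Y hY => exact ⟨Y, 𝟙 Y, 𝟙 Y, rfl, .zero hY⟩
  | @shift Z n hs =>
    refine ⟨Z, 𝟙 Z, 𝟙 Z, rfl, .succ (f := (0 : zeroMod A ⟶ Z)) (g := 𝟙 Z) ?_
      (.zero (projective_zeroMod A)) hs⟩
    exact .mk (fun x _ => Subsingleton.elim _ _) (fun _ => rfl)
      (fun y hy => ⟨0, Eq.trans (by simp) hy.symm⟩) (fun z => ⟨z, rfl⟩)
  | @ext X Y Z m n f g h _ _ ihX ihZ =>
    obtain ⟨X', s, r, hsr, hX'⟩ := ihX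
    obtain ⟨Z', s', r', hsr', hZ'⟩ := ihZ
    have hs : ∀ x, lin r (lin s x) = x := comp_apply hsr
    have hs' : ∀ x, lin r' (lin s' x) = x := comp_apply hsr'
    obtain ⟨c, hc⟩ := exists_complement hsr
    obtain ⟨c', hc'⟩ := exists_complement hsr'
    have h0 : ∀ y, lin r (lin (kerι r) y) = 0 := fun y => y.2
    have h0' : ∀ y, lin r' (lin (kerι r') y) = 0 := fun y => y.2
    refine ⟨prod (prod Y (ker r)) (ker r'), inl _ _ ≫ inl _ _, fst _ _ ≫ fst _ _, rfl,
      hX'.ext hZ' (f := pair (r ≫ f) c ≫ inl _ _) (g := copair (fst _ _ ≫ g ≫ s') (kerι r')) ?_⟩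
    refine .mk ?_ ?_ ?_ ?_
    · intro x hx
      have h1 : lin f (lin r x) = 0 := congrArg (fun z => z.1.1) hx
      have h2 : lin c x = 0 := congrArg (fun z => z.1.2) hx
      have := hc x
      rw [h2, h.inj h1, map_zero, map_zero, sub_zero] at this
      exact this.symm
    · intro x
      change lin s' (lin g (lin f (lin r x))) + lin (kerι r') 0 = 0
      rw [h.zero, map_zero, map_zero, add_zero]
    · rintro ⟨⟨y, x⟩, z⟩ hyz
      change lin s' (lin g y) + lin (kerι r') z = 0 at hyz
      have h1 := congrArg (lin r') hyz
      rw [map_add, hs', h0', add_zero, map_zero] at h1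
      rw [h1, map_zero, zero_add] at hyz
      obtain ⟨x', rfl⟩ := h.exact h1
      have h2 : lin r (lin s x' + lin (kerι r) x) = x' := by rw [map_add, hs, h0, add_zero]
      refine ⟨lin s x' + lin (kerι r) x, Prod.ext (Prod.ext ?_ ?_) ?_⟩
      · exact congrArg (lin f) h2
      · refine Subtype.ext ((hc _).trans ?_)
        rw [h2, add_sub_cancel_left]
        rfl
      · exact Subtype.ext hyz.symm
    · intro z
      obtain ⟨y, hy⟩ := h.surj (lin r' z)
      refine ⟨((y, 0), lin c' z), ?_⟩
      change lin s' (lin g y) + lin (kerι r') (lin c' z) = z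
      rw [hy, hc', add_sub_cancel]
  | @retract X Y m s r hsr _ ih =>
    obtain ⟨Y', s', r', hsr', hY'⟩ := ih
    refine ⟨Y', s ≫ s', r' ≫ r, ?_, hY'⟩
    rw [Category.assoc, reassoc_of% hsr', hsr]

theorem Filtered.exists_filtration {Y : GrMod A} (h : Filtered G n Y) :
    ∃ F : ℕ → StMod A, IsZero (F 0) ∧ (∀ i < n, ∃ (Z : StMod A) (f : F i ⟶ F (i + 1))
      (g : F (i + 1) ⟶ Z) (n : ℤ), IsCofiberSeq f g ∧ IsShift G n Z) ∧ F n = (Q A).obj Y := by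
  induction h with
  | @zero Y hY => exact ⟨fun _ => (Q A).obj Y, isZero_of_projective hY, by simp, rfl⟩
  | @succ X Y Z n N f g h _ hs ih =>
    obtain ⟨F, h0, hF, hn⟩ := ih
    -- Only the values up to `n + 1` matter; the later ones are filler.
    let F' : ℕ → StMod A := fun i => if i ≤ n then F i else (Q A).obj Y
    have hF' : ∀ i, i ≤ n → F' i = F i := fun i hi => if_pos hi
    have hn' : F' (n + 1) = (Q A).obj Y := if_neg (by omega)
    refine ⟨F', by rwa [hF' 0 (by omega)], fun i hi => ?_, hn'⟩
    by_cases hin : i = n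
    · subst hin
      rw [hn', hF' i le_rfl, hn]
      exact ⟨_, _, _, N, .of_isShortExact h, hs⟩
    · rw [hF' i (by omega), hF' (i + 1) (by omega)]
      exact hF i (by omega)

theorem Built.complexity_le {Y : StMod A} (h : Built G m Y.as) : complexity G Y ≤ m := by
  obtain ⟨Y', s, r, hsr, hY'⟩ := h.exists_filtered
  obtain ⟨F, h0, hF, hm⟩ := hY'.exists_filtration
  refine iInf₂_le m ⟨F, h0, hF, ⟨?_⟩⟩
  rw [hm]
  exact ⟨(Q A).map s, (Q A).map r, by rw [← (Q A).map_comp, hsr]; exact (Q A).map_id _⟩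

/-- A filtration of length `0` would make `Y` a retract of a zero object, hence projective. -/
theorem one_le_complexity {Y : StMod A} (hY : ¬ Module.Projective A Y.as) :
    1 ≤ complexity G Y := by
  refine le_iInf₂ fun n hn => ?_
  obtain ⟨F, h0, -, ⟨h⟩⟩ := hn
  rw [Nat.one_le_cast, Nat.one_le_iff_ne_zero]
  rintro rfl
  obtain ⟨r⟩ := retract_zeroMod h0
  exact hY (projective_of_retract (X := Y.as) (h.trans r) (projective_zeroMod A))

/-! ### Thick subcategories -/

theorem isThick_thick (S : Set (StMod A)) : IsThick (thick S) where
  zero X hX _ hP _ := hP.zero X hX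
  left f g h hY hZ P hP hS := hP.left f g h (hY P hP hS) (hZ P hP hS)
  middle f g h hX hZ P hP hS := hP.middle f g h (hX P hP hS) (hZ P hP hS)
  right f g h hX hY P hP hS := hP.right f g h (hX P hP hS) (hY P hP hS)
  retract r hY P hP hS := hP.retract r (hY P hP hS)

theorem built_of_isZero {X : StMod A} (hX : IsZero X) : Built G 0 X.as := by
  obtain ⟨r⟩ := retract_zeroMod hX
  exact .of_retract r (.proj (projective_zeroMod A))

/-- Consequently every object is built from finitely many cells of a generator. -/
theorem isThick_built (hA : A.IsFrobenius) : IsThick fun Y : StMod A => ∃ m, Built G m Y.as where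
  zero _ hX := ⟨0, built_of_isZero hX⟩
  left := by
    rintro X Y Z f g h ⟨m, hY⟩ ⟨n, hZ⟩
    exact ⟨_, h.built_left hY hZ⟩
  middle := by
    rintro X Y Z f g h ⟨m, hX⟩ ⟨n, hZ⟩
    exact ⟨_, h.built_middle hX hZ⟩
  right := by
    rintro X Y Z f g h ⟨m, hX⟩ ⟨n, hY⟩
    exact ⟨_, h.built_right hA hX hY⟩
  retract := by
    rintro X Y h ⟨m, hY⟩
    exact ⟨_, hY.of_retract h⟩

theorem isThick_projective (hA : A.IsFrobenius) :
    IsThick fun Y : StMod A => Module.Projective A Y.as where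
  zero X hX := by
    obtain ⟨r⟩ := retract_zeroMod hX
    exact projective_of_retract (X := X.as) r (projective_zeroMod A)
  left := by
    rintro X Y Z f g ⟨X', Y', Z', i, p, hip, a, b, c, -, -⟩ hY hZ
    exact projective_of_retract (X := X.as) ⟨a.hom, a.inv, a.hom_inv_id⟩ (hip.projective_left
      (projective_of_retract (Y := Y.as) ⟨b.inv, b.hom, b.inv_hom_id⟩ hY)
      (projective_of_retract (Y := Z.as) ⟨c.inv, c.hom, c.inv_hom_id⟩ hZ))
  middle := by
    rintro X Y Z f g ⟨X', Y', Z', i, p, hip, a, b, c, -, -⟩ hX hZ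
    exact projective_of_retract (X := Y.as) ⟨b.hom, b.inv, b.hom_inv_id⟩ (hip.projective_middle
      (projective_of_retract (Y := X.as) ⟨a.inv, a.hom, a.inv_hom_id⟩ hX)
      (projective_of_retract (Y := Z.as) ⟨c.inv, c.hom, c.inv_hom_id⟩ hZ))
  right := by
    rintro X Y Z f g ⟨X', Y', Z', i, p, hip, a, b, c, -, -⟩ hX hY
    exact projective_of_retract (X := Z.as) ⟨c.hom, c.inv, c.hom_inv_id⟩ (hip.projective_right hA
      (projective_of_retract (Y := X.as) ⟨a.inv, a.hom, a.inv_hom_id⟩ hX)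
      (projective_of_retract (Y := Y.as) ⟨b.inv, b.hom, b.inv_hom_id⟩ hY))
  retract h hY := projective_of_retract h hY

end StMod

/-! ### Monogenic Hopf algebras and extensions -/

namespace GrHopf

variable {k : Type u} [Field k]

theorem exists_deg_eq_bot (A : GrHopf k) : ∃ N : ℤ, ∀ n > N, A.deg n = ⊥ := by
  have hind := (DirectSum.Decomposition.isInternal A.deg).submodule_iSupIndep
  have hfin : {n | A.deg n ≠ ⊥}.Finite := WellFoundedGT.finite_ne_bot_of_iSupIndep hind
  obtain ⟨N, hN⟩ := hfin.bddAbove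
  refine ⟨N, fun n hn => ?_⟩
  by_contra hne
  exact absurd (hN hne) (not_le.2 hn)

theorem induction_deg {A : GrHopf k} {p : A → Prop} (zero : p 0) (deg : ∀ n, ∀ a ∈ A.deg n, p a)
    (add : ∀ a b, p a → p b → p (a + b)) (a : A) : p a :=
  DirectSum.Decomposition.inductionOn A.deg zero (fun m => deg _ m.1 m.2) add a

theorem eq_smul_one_of_mem {A : GrHopf k} {a : A} (ha : a ∈ A.deg 0) :
    a = Coalgebra.counit (R := k) a • (1 : A) := by
  rw [A.deg_zero, Submodule.mem_span_singleton] at ha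
  obtain ⟨c, rfl⟩ := ha
  rw [map_smul, A.counit_one, smul_eq_mul, mul_one]

theorem one_ne_zero (A : GrHopf k) : (1 : A) ≠ 0 := by
  intro h
  have := A.counit_one
  rw [h, map_zero] at this
  exact zero_ne_one this

/-! #### The antipode -/

/-- The sign in the antimultiplicativity of the antipode is exactly the sign of the graded symmetry.
-/
theorem antipode_mul_comm (A : GrHopf k) (y : A ⊗[k] A) :
    A.antipode (LinearMap.mul' k A (A.antipode.lTensor A y)) =
      LinearMap.mul' k A (TensorProduct.map (A.antipode ∘ₗ A.antipode) A.antipode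
        ((GradedTensorProduct.of k A.deg A.deg).symm (GradedTensorProduct.comm A.deg A.deg
          (GradedTensorProduct.of k A.deg A.deg y)))) := by
  induction y using TensorProduct.induction_on with
  | zero => simp
  | add x y hx hy => simp only [map_add, hx, hy]
  | tmul a b =>
    induction a using induction_deg with
    | zero => simp
    | add a a' ha ha' => simp only [TensorProduct.add_tmul, map_add, ha, ha']
    | deg i a ha =>
      induction b using induction_deg with
      | zero => simp
      | add b b' hb hb' => simp only [TensorProduct.tmul_add, map_add, hb, hb']
      | deg j b hb =>
        have := GradedTensorProduct.comm_coe_tmul_coe (R := k) A.deg A.deg (⟨a, ha⟩ : A.deg i)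
          (⟨b, hb⟩ : A.deg j)
        rw [this, LinearMap.lTensor_tmul, LinearMap.mul'_apply,
          A.antipode_mul i j a ha _ (A.antipode_deg j b hb), mul_comm j i]
        rw [Int.negOnePow_def, Units.smul_def, Units.smul_def, map_zsmul, map_zsmul, map_zsmul]
        simp

/-- In the convolution algebra, `S²` is a left inverse of `S` and the identity is a right inverse.
For the former, apply `S` to the antipode identity and remove the resulting symmetry by
cocommutativity. -/
theorem antipode_antipode (A : GrHopf k) (a : A) : A.antipode (A.antipode a) = a := by
  let S : WithConv (A →ₗ[k] A) := WithConv.toConv A.antipode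
  let I : WithConv (A →ₗ[k] A) := WithConv.toConv LinearMap.id
  let S2 : WithConv (A →ₗ[k] A) := WithConv.toConv (A.antipode ∘ₗ A.antipode)
  have h1 : S * I = 1 := by
    ext a
    exact A.mul_antipode_rTensor_comul a
  have h2 : S2 * S = 1 := by
    ext a
    have := A.antipode_mul_comm (Coalgebra.comul a)
    rw [A.cocomm, A.mul_antipode_lTensor_comul, Algebra.algebraMap_eq_smul_one, map_smul,
      A.antipode_one, GradedTensorProduct.of_symm_of, ← Algebra.algebraMap_eq_smul_one] at this
    exact this.symm
  have h3 : S2 = I := left_inv_eq_right_inv h2 h1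
  exact LinearMap.congr_fun (congrArg WithConv.ofConv h3) a

theorem Hom.counit_apply {A B : GrHopf k} (f : Hom A B) (a : A) :
    Coalgebra.counit (R := k) (f a) = Coalgebra.counit (R := k) a :=
  CoalgHomClass.counit_comp_apply f.toBialgHom a

/-- Both sides are convolution inverses of `f`. -/
theorem Hom.antipode_apply {A B : GrHopf k} (f : Hom A B) (a : A) :
    B.antipode (f a) = f (A.antipode a) := by
  let g : A →ₗ[k] B := ((f.toBialgHom : A →ₗc[k] B) : A →ₗ[k] B)
  let F : WithConv (A →ₗ[k] B) := WithConv.toConv g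
  have h1 : WithConv.toConv (B.antipode ∘ₗ g) * F = 1 := by
    have h : (WithConv.toConv B.antipode * WithConv.toConv LinearMap.id :
        WithConv (B →ₗ[k] B)) = 1 := by
      ext b
      exact B.mul_antipode_rTensor_comul b
    have := LinearMap.convMul_comp_coalgHom_distrib (WithConv.toConv B.antipode)
      (WithConv.toConv LinearMap.id) (f.toBialgHom : A →ₗc[k] B)
    rw [h] at this
    apply WithConv.ofConv_injective
    refine this.symm.trans ?_
    ext a
    change algebraMap k B (Coalgebra.counit (R := k) (f a)) = _
    rw [f.counit_apply]
    rfl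
  have h2 : F * WithConv.toConv (g ∘ₗ A.antipode) = 1 := by
    have h : (WithConv.toConv LinearMap.id * WithConv.toConv A.antipode :
        WithConv (A →ₗ[k] A)) = 1 := by
      ext b
      exact A.mul_antipode_lTensor_comul b
    have := LinearMap.algHom_comp_convMul_distrib (f.toBialgHom : A →ₐ[k] B)
      (WithConv.toConv LinearMap.id) (WithConv.toConv A.antipode)
    rw [h] at this
    apply WithConv.ofConv_injective
    refine this.symm.trans ?_
    ext a
    exact (f.toBialgHom : A →ₐ[k] B).commutes _
  exact LinearMap.congr_fun (congrArg WithConv.ofConv (left_inv_eq_right_inv h1 h2)) a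

/-! #### Monogenic Hopf algebras -/

/-- A generator of degree at most `0` is a scalar by connectedness; then `M = k`, and `0`, placed in
degree `1`, also generates. -/
theorem IsMonogenic.exists_pos {M : GrHopf k} (h : M.IsMonogenic) :
    ∃ (d : ℤ) (x : M), 0 < d ∧ x ∈ M.deg d ∧ Algebra.adjoin k {x} = ⊤ := by
  obtain ⟨d, x, hx, hgen⟩ := h
  rcases lt_or_ge 0 d with hd | hd
  · exact ⟨d, x, hd, hx, hgen⟩
  have hx' : ∃ c : k, algebraMap k M c = x := by
    rcases hd.lt_or_eq with hd | rfl
    · rw [M.deg_neg d hd, Submodule.mem_bot] at hx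
      exact ⟨0, by rw [hx, map_zero]⟩
    · exact ⟨_, by rw [Algebra.algebraMap_eq_smul_one]; exact (eq_smul_one_of_mem hx).symm⟩
  refine ⟨1, 0, one_pos, zero_mem _, top_le_iff.1 ?_⟩
  rw [← hgen]
  refine Algebra.adjoin_le ?_
  rintro _ rfl
  obtain ⟨c, hc⟩ := hx'
  rw [← hc]
  exact Subalgebra.algebraMap_mem _ c

/-- A monogenic Hopf algebra is a truncated polynomial algebra `k[x] / x ^ (N + 1)`, where `x` has
positive degree. -/
theorem IsMonogenic.exists_generator {M : GrHopf k} (h : M.IsMonogenic) :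
    ∃ (d : ℤ) (x : M) (N : ℕ), 0 < d ∧ x ∈ M.deg d ∧
      (∀ m : M, ∃ m', m = Coalgebra.counit (R := k) m • 1 + x * m') ∧
      (∀ m : M, x * m = m * x) ∧ x ^ N ≠ 0 ∧ x ^ (N + 1) = 0 := by
  obtain ⟨d, x, hd, hx, hgen⟩ := h.exists_pos
  have hx0 : Coalgebra.counit (R := k) x = 0 := M.counit_deg d hd.ne' x hx
  have hpoly : ∀ m : M, ∃ q : Polynomial k, Polynomial.aeval x q = m := by
    intro m
    have : m ∈ Algebra.adjoin k {x} := by rw [hgen]; trivial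
    rwa [Algebra.adjoin_singleton_eq_range_aeval] at this
  -- The powers of `x` climb beyond the top degree of `M`.
  have hnil : ∃ n, x ^ n = 0 := by
    obtain ⟨N, hN⟩ := M.exists_deg_eq_bot
    refine ⟨(N + 1).toNat, ?_⟩
    have h1 := SetLike.pow_mem_graded (N + 1).toNat hx
    by_cases hN0 : 0 ≤ N
    · rwa [hN, Submodule.mem_bot] at h1
      rw [nsmul_eq_mul, Int.toNat_of_nonneg (by omega)]
      nlinarith
    · exfalso
      have h0 : (1 : M) ∈ M.deg 0 := SetLike.GradedOne.one_mem
      rw [hN 0 (by omega), Submodule.mem_bot] at h0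
      exact M.one_ne_zero h0
  classical
  have hpos : Nat.find hnil ≠ 0 := by
    intro h0
    have := Nat.find_spec hnil
    rw [h0, pow_zero] at this
    exact M.one_ne_zero this
  -- `N + 1` is the nilpotency index. The value `N = 0` occurs when `x = 0`, that is, for `M = k`.
  obtain ⟨N, hN⟩ := Nat.exists_eq_succ_of_ne_zero hpos
  refine ⟨d, x, N, hd, hx, fun m => ?_, fun m => ?_, Nat.find_min hnil (by omega), ?_⟩
  · obtain ⟨q, rfl⟩ := hpoly m
    have e : Polynomial.aeval x q = q.coeff 0 • (1 : M) + x * Polynomial.aeval x q.divX := by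
      conv_lhs => rw [← Polynomial.X_mul_divX_add q]
      rw [map_add, map_mul, Polynomial.aeval_X, Polynomial.aeval_C, add_comm,
        Algebra.algebraMap_eq_smul_one]
    refine ⟨Polynomial.aeval x q.divX, ?_⟩
    have e2 : Coalgebra.counit (R := k) (Polynomial.aeval x q) = q.coeff 0 := by
      rw [e, map_add, map_smul, M.counit_one, M.counit_mul, hx0, zero_mul, add_zero, smul_eq_mul,
        mul_one]
    rw [e2]
    exact e
  · obtain ⟨q, rfl⟩ := hpoly m
    have e := congrArg (Polynomial.aeval x) (mul_comm Polynomial.X q)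
    rwa [map_mul, map_mul, Polynomial.aeval_X] at e
  · have := Nat.find_spec hnil
    rwa [hN] at this

section Truncated

variable {M : GrHopf k} {x : M} {N : ℕ}

theorem exact_counit (hM : ∀ m : M, ∃ m', m = Coalgebra.counit (R := k) m • 1 + x * m')
    (hx : Coalgebra.counit (R := k) x = 0) :
    Function.Exact (LinearMap.mulLeft k x) (Coalgebra.counit (R := k) (A := M)) := by
  intro m
  constructor
  · intro hm
    obtain ⟨m', hm'⟩ := hM m
    rw [hm, zero_smul, zero_add] at hm'
    exact ⟨m', hm'.symm⟩
  · rintro ⟨m', rfl⟩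
    rw [LinearMap.mulLeft_apply, M.counit_mul, hx, zero_mul]

theorem exact_pow_mul (hM : ∀ m : M, ∃ m', m = Coalgebra.counit (R := k) m • 1 + x * m')
    (hN : x ^ N ≠ 0) (hN1 : x ^ (N + 1) = 0) :
    Function.Exact (LinearMap.mulLeft k x) (LinearMap.mulLeft k (x ^ N)) := by
  intro m
  constructor
  · intro hm
    obtain ⟨m', hm'⟩ := hM m
    rw [LinearMap.mulLeft_apply, hm', mul_add, ← mul_assoc, ← pow_succ, hN1, zero_mul, add_zero,
      mul_smul_comm, mul_one, smul_eq_zero_iff_left hN] at hm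
    rw [hm, zero_smul, zero_add] at hm'
    exact ⟨m', hm'.symm⟩
  · rintro ⟨m', rfl⟩
    rw [LinearMap.mulLeft_apply, LinearMap.mulLeft_apply, ← mul_assoc, ← pow_succ, hN1, zero_mul]

theorem exact_mul_pow (hM : ∀ m : M, ∃ m', m = Coalgebra.counit (R := k) m • 1 + x * m')
    (hN : x ^ N ≠ 0) (hN1 : x ^ (N + 1) = 0) :
    Function.Exact (LinearMap.mulLeft k (x ^ N)) (LinearMap.mulLeft k x) := by
  intro m
  constructor
  · intro hm
    rw [LinearMap.mulLeft_apply] at hm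
    suffices h : ∀ j ≤ N, ∃ m', m = x ^ j * m' by
      obtain ⟨m', hm'⟩ := h N le_rfl
      exact ⟨m', hm'.symm⟩
    intro j hj
    induction j with
    | zero => exact ⟨m, by simp⟩
    | succ j ih =>
      obtain ⟨m', hm'⟩ := ih (by omega)
      obtain ⟨m'', hm''⟩ := hM m'
      -- Multiplying `x * m = 0` by `x ^ (N - 1 - j)` shows that the constant term of `m'` vanishes,
      -- so one more factor `x` can be extracted.
      have h1 : x ^ N * m' = 0 := by
        have e : N = (N - 1 - j) + 1 + j := by omega
        rw [e, pow_add, pow_succ, mul_assoc, ← hm', mul_assoc, hm, mul_zero]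
      rw [hm'', mul_add, ← mul_assoc, ← pow_succ, hN1, zero_mul, add_zero,
        mul_smul_comm, mul_one, smul_eq_zero_iff_left hN] at h1
      rw [h1, zero_smul, zero_add] at hm''
      exact ⟨m'', by rw [hm', hm'', ← mul_assoc, ← pow_succ]⟩
  · rintro ⟨m', rfl⟩
    rw [LinearMap.mulLeft_apply, LinearMap.mulLeft_apply, ← mul_assoc, ← pow_succ', hN1, zero_mul]

end Truncated

end GrHopf

namespace GrHopf

variable {k : Type u} [Field k]

/-- The surjection `p : B → C` is the quotient by the ideal generated by a normal element `x` of
positive degree, and `B` is free over `k[x] / x ^ (N + 1)` on both sides. -/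
structure IsTruncated {B C : GrHopf k} (p : Hom B C) (d : ℤ) (x : B) (N : ℕ) : Prop where
  pos : 0 < d
  mem : x ∈ B.deg d
  surjective : Function.Surjective p
  left_ker : ∀ b, p b = 0 ↔ ∃ c, x * c = b
  left_mul_eq_zero : ∀ b, x * b = 0 ↔ ∃ c, x ^ N * c = b
  left_pow_mul_eq_zero : ∀ b, x ^ N * b = 0 ↔ p b = 0
  normal : ∀ b, ∃ c, x * b = c * x
  pow_succ : x ^ (N + 1) = 0

theorem Hom.map_mul {A B : GrHopf k} (f : Hom A B) (a b : A) : f (a * b) = f a * f b :=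
  _root_.map_mul f.toBialgHom a b

theorem Hom.map_one {A B : GrHopf k} (f : Hom A B) : f (1 : A) = 1 :=
  _root_.map_one f.toBialgHom

theorem Hom.map_pow {A B : GrHopf k} (f : Hom A B) (a : A) (n : ℕ) : f (a ^ n) = f a ^ n :=
  _root_.map_pow f.toBialgHom a n

/-- The underlying linear map of a morphism of Hopf algebras. -/
def Hom.lin {A B : GrHopf k} (f : Hom A B) : A →ₗ[k] B :=
  ((f.toBialgHom : A →ₗc[k] B) : A →ₗ[k] B)

@[simp] theorem Hom.lin_apply {A B : GrHopf k} (f : Hom A B) (a : A) : f.lin a = f a := rfl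

/-! ### Extensions by a monogenic Hopf algebra. -/

section Extension

variable {M B C : GrHopf k} {p : Hom B C} {φ : B ≃ₗ[k] M ⊗[k] C}

/-- The counit of a tensor product. -/
def counitTensor (M C : GrHopf k) : M ⊗[k] C →ₗ[k] k :=
  TensorProduct.lift (LinearMap.mk₂ k
    (fun (m : M) (c : C) => Coalgebra.counit (R := k) m * Coalgebra.counit (R := k) c)
    (fun _ _ _ => by rw [map_add, add_mul]) (fun _ _ _ => by rw [map_smul, smul_mul_assoc])
    (fun _ _ _ => by rw [map_add, mul_add]) (fun _ _ _ => by rw [map_smul, mul_smul_comm]))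

@[simp] theorem counitTensor_tmul (m : M) (c : C) : counitTensor M C (m ⊗ₜ c) =
    Coalgebra.counit (R := k) m * Coalgebra.counit (R := k) c := rfl

theorem counitTensor_eq_zero {n : ℤ} (hn : n ≠ 0) {y : M ⊗[k] C}
    (hy : y ∈ tensorDeg M.deg C.deg n) : counitTensor M C y = 0 := by
  have hle : tensorDeg M.deg C.deg n ≤ LinearMap.ker (counitTensor M C) := by
    refine iSup_le fun m => Submodule.map₂_le.2 fun a ha c hc => ?_
    rw [LinearMap.mem_ker, TensorProduct.mk_apply, counitTensor_tmul]
    by_cases hm : m = 0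
    · rw [C.counit_deg _ (by omega) c hc, mul_zero]
    · rw [M.counit_deg _ hm a ha, zero_mul]
  exact hle hy

/-- Both functionals vanish in nonzero degrees, and degree `0` is spanned by `1`. The scalar is
needed because `φ` is not assumed to send `1` to `1 ⊗ 1`. -/
theorem counitTensor_apply (hdeg : ∀ (n : ℤ), ∀ b ∈ B.deg n, φ b ∈ tensorDeg M.deg C.deg n)
    (b : B) : counitTensor M C (φ b) =
      counitTensor M C (φ 1) * Coalgebra.counit (R := k) b := by
  induction b using induction_deg with
  | zero => simp
  | add a b ha hb => rw [map_add, map_add, map_add, ha, hb, mul_add]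
  | deg n b hb =>
    by_cases hn : n = 0
    · subst hn
      conv_lhs => rw [eq_smul_one_of_mem hb]
      rw [map_smul, map_smul, smul_eq_mul, mul_comm]
    · rw [counitTensor_eq_zero hn (hdeg n b hb), B.counit_deg n hn b hb, mul_zero]

theorem counitTensor_one_ne_zero
    (hdeg : ∀ (n : ℤ), ∀ b ∈ B.deg n, φ b ∈ tensorDeg M.deg C.deg n) :
    counitTensor M C (φ 1) ≠ 0 := by
  intro h
  have := counitTensor_apply hdeg (φ.symm (1 ⊗ₜ 1))
  rw [h, zero_mul, LinearEquiv.apply_symm_apply, counitTensor_tmul, M.counit_one, C.counit_one,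
    one_mul] at this
  exact _root_.one_ne_zero this

/-- The projection of an extension in terms of the trivialization. -/
theorem smul_proj_eq (hdeg : ∀ (n : ℤ), ∀ b ∈ B.deg n, φ b ∈ tensorDeg M.deg C.deg n)
    (hco : ∀ b : B,
      φ.toLinearMap.rTensor C (p.lin.lTensor B (Coalgebra.comul b)) =
        (TensorProduct.assoc k M C C).symm
          ((Coalgebra.comul (R := k) (A := C)).lTensor M (φ b))) (b : B) :
    counitTensor M C (φ 1) • p b = TensorProduct.lid k C
      ((Coalgebra.counit (R := k) (A := M)).rTensor C (φ b)) := by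
  -- Apply `(ε ⊗ ε) ⊗ id` to the colinearity of `φ`; the counit axioms of `B` and `C` reduce the two
  -- sides to the claim.
  have h := congrArg (fun z => TensorProduct.lid k C ((counitTensor M C).rTensor C z)) (hco b)
  have hl : (counitTensor M C).comp φ.toLinearMap =
      counitTensor M C (φ 1) • Coalgebra.counit (R := k) (A := B) :=
    LinearMap.ext fun b => counitTensor_apply hdeg b
  have h1 : ∀ z : B ⊗[k] B, TensorProduct.lid k C ((counitTensor M C).rTensor C
      (φ.toLinearMap.rTensor C (p.lin.lTensor B z))) = counitTensor M C (φ 1) •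
        p.lin (TensorProduct.lid k B ((Coalgebra.counit (R := k) (A := B)).rTensor B z)) := by
    intro z
    induction z using TensorProduct.induction_on with
    | zero => simp
    | add x y hx hy => simp only [map_add, smul_add, hx, hy]
    | tmul x y =>
      rw [LinearMap.lTensor_tmul, LinearMap.rTensor_tmul, LinearMap.rTensor_tmul,
        LinearMap.rTensor_tmul, TensorProduct.lid_tmul, TensorProduct.lid_tmul, map_smul,
        smul_smul]
      congr 1
      exact LinearMap.congr_fun hl x
  have h2 : ∀ z : M ⊗[k] C, TensorProduct.lid k C ((counitTensor M C).rTensor C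
      ((TensorProduct.assoc k M C C).symm ((Coalgebra.comul (R := k) (A := C)).lTensor M z))) =
        TensorProduct.lid k C ((Coalgebra.counit (R := k) (A := M)).rTensor C z) := by
    intro z
    induction z using TensorProduct.induction_on with
    | zero => simp
    | add x y hx hy => simp only [map_add, hx, hy]
    | tmul m c =>
      have h3 : ∀ w : C ⊗[k] C, TensorProduct.lid k C ((counitTensor M C).rTensor C
          ((TensorProduct.assoc k M C C).symm (m ⊗ₜ w))) = Coalgebra.counit (R := k) m •
            TensorProduct.lid k C ((Coalgebra.counit (R := k) (A := C)).rTensor C w) := by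
        intro w
        induction w using TensorProduct.induction_on with
        | zero => simp
        | add x y hx hy => simp only [TensorProduct.tmul_add, map_add, smul_add, hx, hy]
        | tmul x y =>
          rw [TensorProduct.assoc_symm_tmul, LinearMap.rTensor_tmul, LinearMap.rTensor_tmul,
            TensorProduct.lid_tmul, TensorProduct.lid_tmul, counitTensor_tmul, smul_smul]
      rw [LinearMap.lTensor_tmul, h3, Coalgebra.rTensor_counit_comul, LinearMap.rTensor_tmul,
        TensorProduct.lid_tmul, TensorProduct.lid_tmul, one_smul]
  rw [h1, h2, Coalgebra.rTensor_counit_comul, TensorProduct.lid_tmul, one_smul] at h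
  exact h

/-- The exact sequences of multiplications by `x` and `x ^ N` on `M` are tensored with `C` and
carried to `B` by `φ`. Normality of `x` is not visible from `φ`, which is only left linear; it comes
from the antipode. -/
theorem IsExtension.exists_isTruncated {i : Hom M B} (h : IsExtension i p) (hM : M.IsMonogenic) :
    ∃ (d : ℤ) (x : B) (N : ℕ), IsTruncated p d x N := by
  obtain ⟨φ, hdeg, hlin, hco⟩ := h
  obtain ⟨d, x, N, hd, hx, hgen, hcomm, hN, hN1⟩ := hM.exists_generator
  have hx0 : Coalgebra.counit (R := k) x = 0 := M.counit_deg d hd.ne' x hx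
  have hproj := smul_proj_eq hdeg hco
  have hne := counitTensor_one_ne_zero hdeg
  have hcounit : Function.Surjective (Coalgebra.counit (R := k) (A := M)) := fun c =>
    ⟨c • 1, by rw [map_smul, M.counit_one, smul_eq_mul, mul_one]⟩
  have hsurj : Function.Surjective p := by
    intro c
    refine ⟨counitTensor M C (φ 1) • φ.symm (1 ⊗ₜ c), ?_⟩
    rw [← p.lin_apply, map_smul, p.lin_apply, hproj, LinearEquiv.apply_symm_apply,
      LinearMap.rTensor_tmul, M.counit_one, TensorProduct.lid_tmul, one_smul]
  have hker : ∀ b, p b = 0 ↔ ∃ c, i x * c = b := by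
    intro b
    have e := rTensor_exact C (exact_counit hgen hx0) hcounit (φ b)
    rw [← smul_eq_zero_iff_right hne, hproj, LinearEquiv.map_eq_zero_iff, e]
    constructor
    · rintro ⟨z, hz⟩
      refine ⟨φ.symm z, φ.injective ?_⟩
      rw [hlin, LinearEquiv.apply_symm_apply, hz]
    · rintro ⟨c, rfl⟩
      exact ⟨φ c, (hlin x c).symm⟩
  have hexact : ∀ a a' : M, Function.Exact (LinearMap.mulLeft k a) (LinearMap.mulLeft k a') →
      ∀ b, i a' * b = 0 ↔ ∃ c, i a * c = b := by
    intro a a' haa b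
    have e := Module.Flat.rTensor_exact C haa (φ b)
    rw [← φ.map_eq_zero_iff, hlin, e]
    constructor
    · rintro ⟨z, hz⟩
      refine ⟨φ.symm z, φ.injective ?_⟩
      rw [hlin, LinearEquiv.apply_symm_apply, hz]
    · rintro ⟨c, rfl⟩
      exact ⟨φ c, (hlin a c).symm⟩
  have hpx : p (i x) = 0 := (hker _).2 ⟨1, mul_one _⟩
  have hright : ∀ b, ∃ c, i x * c = b * i x := fun b => (hker _).1 (by
    rw [p.map_mul, hpx, mul_zero])
  -- The antipode of `x` has positive degree, hence no constant term, and is a multiple of `x`.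
  obtain ⟨m', hm'⟩ := hgen (M.antipode x)
  rw [M.counit_deg d hd.ne' _ (M.antipode_deg d x hx), zero_smul, zero_add, hcomm] at hm'
  have hSx : B.antipode (i x) = i m' * i x := by rw [i.antipode_apply, hm', i.map_mul]
  have hS : ∀ b, ∃ c, B.antipode (i x * b) = c * i x := by
    intro b
    induction b using induction_deg with
    | zero => exact ⟨0, by simp⟩
    | add a b ha hb =>
      obtain ⟨c, hc⟩ := ha
      obtain ⟨c', hc'⟩ := hb
      exact ⟨c + c', by rw [mul_add, map_add, hc, hc', add_mul]⟩
    | deg n b hb =>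
      refine ⟨(d * n).negOnePow • (B.antipode b * i m'), ?_⟩
      rw [B.antipode_mul d n _ (i.map_deg d x hx) b hb, hSx, smul_mul_assoc, mul_assoc]
  refine ⟨d, i x, N, hd, i.map_deg d x hx, hsurj, hker, ?_, ?_, ?_, ?_⟩
  · intro b
    rw [← i.map_pow]
    exact hexact _ _ (exact_mul_pow hgen hN hN1) b
  · intro b
    rw [← i.map_pow, hker]
    exact hexact _ _ (exact_pow_mul hgen hN hN1) b
  -- `S(xB) ⊆ Bx ⊆ xB`, the second inclusion because `xB` is the kernel of `p`. Applying `S` once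
  -- more and using `S² = id` gives `xB ⊆ Bx`.
  · intro b
    obtain ⟨c, hc⟩ := hS b
    obtain ⟨c', hc'⟩ := hright c
    obtain ⟨c'', hc''⟩ := hS c'
    exact ⟨c'', by rw [← hc'', hc', ← hc, antipode_antipode]⟩
  · rw [← i.map_pow, hN1]
    exact map_zero i.lin

end Extension

/-! ### Passage from left to right multiplication, and the Frobenius property. -/

namespace IsTruncated

variable {B C : GrHopf k} {p : Hom B C} {d : ℤ} {x : B} {N : ℕ}


theorem map_self (h : IsTruncated p d x N) : p x = 0 := (h.left_ker x).2 ⟨1, mul_one x⟩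

theorem pow_normal (h : IsTruncated p d x N)
    (j : ℕ) (b : B) : ∃ c, x ^ j * b = c * x ^ j := by
  induction j generalizing b with
  | zero => exact ⟨b, by simp⟩
  | succ j ih =>
    obtain ⟨c, hc⟩ := h.normal b
    obtain ⟨c', hc'⟩ := ih c
    exact ⟨c', by rw [_root_.pow_succ, mul_assoc, hc, ← mul_assoc, hc', mul_assoc]⟩

theorem exists_mul_pow (h : IsTruncated p d x N)
    (j : ℕ) (b : B) : ∃ c, b * x ^ j = x ^ j * c := by
  induction j generalizing b with
  | zero => exact ⟨b, by simp⟩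
  | succ j ih =>
    obtain ⟨c, hc⟩ := (h.left_ker (b * x)).1 (by rw [p.map_mul, h.map_self, mul_zero])
    obtain ⟨c', hc'⟩ := ih c
    exact ⟨c', by rw [pow_succ', ← mul_assoc, ← hc, mul_assoc, hc', mul_assoc]⟩

theorem range_mulRight (h : IsTruncated p d x N)
    (j : ℕ) : LinearMap.range (LinearMap.mulRight k (x ^ j)) =
    LinearMap.range (LinearMap.mulLeft k (x ^ j)) := by
  ext b
  constructor
  · rintro ⟨c, rfl⟩
    obtain ⟨c', hc'⟩ := h.exists_mul_pow j c
    exact ⟨c', hc'.symm⟩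
  · rintro ⟨c, rfl⟩
    obtain ⟨c', hc'⟩ := h.pow_normal j c
    exact ⟨c', hc'.symm⟩

/-- Left and right multiplication by `x ^ j` have the same image. Counting dimensions then turns
one-sided inclusions of annihilators into the right-handed versions of the exactness statements. -/
theorem finrank_ker_mulRight (h : IsTruncated p d x N)
    (j : ℕ) :
    Module.finrank k (LinearMap.ker (LinearMap.mulRight k (x ^ j))) =
      Module.finrank k (LinearMap.ker (LinearMap.mulLeft k (x ^ j))) := by
  have h1 := (LinearMap.mulRight k (x ^ j)).finrank_range_add_finrank_ker
  have h2 := (LinearMap.mulLeft k (x ^ j)).finrank_range_add_finrank_ker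
  rw [h.range_mulRight] at h1
  omega

theorem right_ker (h : IsTruncated p d x N)
    (b : B) : p b = 0 ↔ ∃ c, c * x = b := by
  rw [h.left_ker]
  have := congrArg (fun V => b ∈ V) (h.range_mulRight 1)
  rw [pow_one] at this
  exact (iff_of_eq this).symm

theorem right_mul_eq_zero (h : IsTruncated p d x N)
    (b : B) : b * x = 0 ↔ ∃ c, c * x ^ N = b := by
  have hle : LinearMap.range (LinearMap.mulRight k (x ^ N)) ≤
      LinearMap.ker (LinearMap.mulRight k x) := by
    rintro _ ⟨c, rfl⟩
    rw [LinearMap.mem_ker, LinearMap.mulRight_apply, LinearMap.mulRight_apply, mul_assoc,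
      ← _root_.pow_succ, h.pow_succ, mul_zero]
  have heq := Submodule.eq_of_le_of_finrank_eq hle (by
    have e := h.finrank_ker_mulRight 1
    rw [pow_one] at e
    have e' : LinearMap.range (LinearMap.mulLeft k (x ^ N)) = LinearMap.ker (LinearMap.mulLeft k x) :=
      Submodule.ext fun b => (h.left_mul_eq_zero b).symm
    rw [e, h.range_mulRight, e'])
  exact (iff_of_eq (congrArg (fun V => b ∈ V) heq)).symm

theorem right_mul_pow_eq_zero (h : IsTruncated p d x N)
    (b : B) : b * x ^ N = 0 ↔ p b = 0 := by
  have hle : LinearMap.ker p.lin ≤ LinearMap.ker (LinearMap.mulRight k (x ^ N)) := by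
    intro c hc
    obtain ⟨c', rfl⟩ := (h.right_ker c).1 hc
    rw [LinearMap.mem_ker, LinearMap.mulRight_apply, mul_assoc, ← pow_succ', h.pow_succ, mul_zero]
  have heq := Submodule.eq_of_le_of_finrank_eq hle (by
    have e : LinearMap.ker p.lin = LinearMap.ker (LinearMap.mulLeft k (x ^ N)) :=
      Submodule.ext fun b => (h.left_pow_mul_eq_zero b).symm
    rw [h.finrank_ker_mulRight, e])
  exact (iff_of_eq (congrArg (fun V => b ∈ V) heq)).symm

theorem isFrobenius (h : IsTruncated p d x N)
    (hC : C.IsFrobenius) : B.IsFrobenius := by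
  obtain ⟨l, hl⟩ := hC
  -- The functional `l'` on `B` is to satisfy `l' (x ^ N * b) = l (p b)`; it exists because `x ^ N *
  -- b = 0` forces `p b = 0`.
  have hmem : l ∘ₗ p.lin ∈ LinearMap.range (LinearMap.mulLeft k (x ^ N)).dualMap := by
    rw [LinearMap.range_dualMap_eq_dualAnnihilator_ker, Submodule.mem_dualAnnihilator]
    intro b hb
    have : p b = 0 := (h.left_pow_mul_eq_zero b).1 hb
    rw [LinearMap.comp_apply, p.lin_apply, this, map_zero]
  obtain ⟨l', hl'⟩ := hmem
  have hl'' : ∀ b, l' (x ^ N * b) = l (p b) := fun b => LinearMap.congr_fun hl' b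
  refine ⟨l', fun b hb => ?_⟩
  classical
  have hex : ∃ j, x ^ (j + 1) * b = 0 := ⟨N, by rw [h.pow_succ, zero_mul]⟩
  -- The last nonzero `x ^ j * b` is killed by `x`, so it equals `x ^ N * c` with `p c ≠ 0`, where
  -- `l` can be applied.
  obtain ⟨j, hj, hj'⟩ : ∃ j, x * (x ^ j * b) = 0 ∧ x ^ j * b ≠ 0 := by
    refine ⟨Nat.find hex, ?_, ?_⟩
    · rw [← mul_assoc, ← pow_succ']
      exact Nat.find_spec hex
    · rcases Nat.eq_zero_or_eq_succ_pred (Nat.find hex) with h0 | h0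
      · rwa [h0, pow_zero, one_mul]
      · have := Nat.find_min hex (Nat.pred_lt_of_lt (Nat.pos_of_ne_zero (by omega)))
        rwa [← Nat.succ_eq_add_one, ← h0] at this
  obtain ⟨c, hc⟩ := (h.left_mul_eq_zero _).1 hj
  have hpc : p c ≠ 0 := by
    intro h0
    apply hj'
    rw [← hc]
    exact (h.left_pow_mul_eq_zero c).2 h0
  obtain ⟨a, ha⟩ := hl _ hpc
  obtain ⟨a', rfl⟩ := h.surjective a
  obtain ⟨a'', ha''⟩ := h.pow_normal N a'
  refine ⟨a'' * x ^ j, ?_⟩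
  rwa [mul_assoc, ← hc, ← mul_assoc, ← ha'', mul_assoc, hl'', p.map_mul]

end IsTruncated

theorem isFrobenius_of_isTrivial {A : GrHopf k} (hA : A.IsTrivial) : A.IsFrobenius := by
  refine ⟨Coalgebra.counit, fun b hb => ⟨1, ?_⟩⟩
  obtain ⟨c, rfl⟩ := hA.2 b
  rw [one_mul, Algebra.algebraMap_eq_smul_one, map_smul, A.counit_one, smul_eq_mul, mul_one]
  rintro rfl
  exact hb (map_zero _)

end GrHopf

/-! ### Modules restricted along morphisms of Hopf algebras -/

namespace GrMod

variable {k : Type u} [Field k] {A : GrHopf k}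

/-- A Hopf algebra over `A` as a graded `A`-module. -/
def resMod {B : GrHopf k} (f : GrHopf.Hom A B) : GrMod A :=
  letI : Module A B := Module.compHom B f.toRingHom
  { carrier := B
    deg := fun n => (B.deg n).toAddSubgroup
    isInternal := DirectSum.Decomposition.isInternal B.deg
    smul_deg := fun m n a ha x hx => SetLike.GradedMul.mul_mem (f.map_deg m a ha) hx
    finite := by
      have : IsScalarTower k A B := ⟨fun c a x => by
        change f.toBialgHom (c • a) * x = c • (f.toBialgHom a * x)
        rw [map_smul, smul_mul_assoc]⟩
      exact Module.Finite.of_restrictScalars_finite k A B }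

/-- The morphism of `A`-modules underlying a morphism of Hopf algebras over `A`. -/
def resMap {B C : GrHopf k} (p : GrHopf.Hom B C) (f : GrHopf.Hom A B) :
    resMod f ⟶ resMod (p.comp f) :=
  mkHom { toFun := fun b => p b
          map_add' := fun x y => map_add p.lin x y
          map_smul' := fun a b => p.map_mul (f a) b } fun n b hb => p.map_deg n b hb

/-- Right multiplication by a homogeneous element. -/
def mulRight {B : GrHopf k} (f : GrHopf.Hom A B) {x : B} {d : ℤ} (hx : x ∈ B.deg d) (s t : ℤ)
    (hst : s = t + d) : twistObj s (resMod f) ⟶ twistObj t (resMod f) :=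
  mkHom { toFun := fun b => HMul.hMul (α := B) (β := B) (γ := B) b x
          map_add' := fun b c => add_mul (R := B) b c x
          map_smul' := fun a b => mul_assoc (G := B) (f a) b x } fun n b hb => by
    have : HMul.hMul (α := B) (β := B) (γ := B) b x ∈ B.deg (n - s + d) :=
      SetLike.GradedMul.mul_mem hb hx
    rwa [show n - s + d = n - t by omega] at this

/-- `K` is the kernel `Bx` of `B → C`. Right multiplication by `x` maps `B(d)` onto it with kernel
`B x^N`, and right multiplication by `x ^ N` identifies `C`, twisted by `(N + 1) d`, with that
kernel. -/
theorem exists_sequences {B C : GrHopf k} {p : GrHopf.Hom B C} {d : ℤ} {x : B} {N : ℕ}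
    (h : GrHopf.IsTruncated p d x N) (f : GrHopf.Hom A B) :
    ∃ (K : GrMod A) (ι : K ⟶ resMod f)
      (ρ : twistObj ((N + 1) * d) (resMod (p.comp f)) ⟶ twistObj d (resMod f))
      (q : twistObj d (resMod f) ⟶ K),
      IsShortExact ι (resMap p f) ∧ IsShortExact ρ q := by
  have hs := isShortExact_ker (resMap p f) h.surjective
  have hxN : x ^ N ∈ B.deg (N * d) := by
    have := SetLike.pow_mem_graded N h.mem
    rwa [nsmul_eq_mul] at this
  let g : twistObj d (resMod f) ⟶ resMod f :=
    mulRight f h.mem d 0 (zero_add d).symm ≫ mkHom LinearMap.id (fun n b hb => by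
      change b ∈ (resMod f).deg (n - 0) at hb
      rwa [sub_zero] at hb)
  have hg : ∀ b : B, lin g b = b * x := fun _ => rfl
  have hpg : ∀ b : B, lin (resMap p f) (lin g b) = 0 := fun b =>
    (p.map_mul b x).trans ((congrArg (p b * ·) h.map_self).trans (mul_zero _))
  obtain ⟨q, hq⟩ := hs.exists_lift g hpg
  have hq' : ∀ b : B, lin (kerι (resMap p f)) (lin q b) = b * x := comp_apply hq
  obtain ⟨ρ, hρ⟩ : ∃ ρ : twistObj ((N + 1) * d) (resMod (p.comp f)) ⟶ twistObj d (resMod f),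
      ∀ b : B, lin ρ (p b) = b * x ^ N := by
    obtain ⟨ρ, hρ⟩ := (hs.twist ((N + 1) * d)).exists_desc
      (mulRight f hxN ((N + 1) * d) d (by ring))
      (fun b => (h.right_mul_pow_eq_zero _).2 (hs.zero b))
    exact ⟨ρ, comp_apply hρ⟩
  refine ⟨_, _, ρ, q, hs, .mk ?_ ?_ ?_ ?_⟩
  · intro c hc
    obtain ⟨b, rfl⟩ := h.surjective c
    exact (h.right_mul_pow_eq_zero b).1 ((hρ b).symm.trans hc)
  · intro c
    obtain ⟨b, rfl⟩ := h.surjective c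
    have e : b * x ^ N * x = 0 := by rw [mul_assoc, ← pow_succ, h.pow_succ, mul_zero]
    exact hs.inj (((congrArg (fun z => lin (kerι (resMap p f)) (lin q z)) (hρ b)).trans
      (hq' (b * x ^ N))).trans e)
  · intro b hb
    obtain ⟨c, rfl⟩ := (h.right_mul_eq_zero b).1 ((hq' b).symm.trans
      ((congrArg (lin (kerι (resMap p f))) hb).trans (map_zero _)))
    exact ⟨p c, hρ c⟩
  · rintro ⟨b, hb⟩
    obtain ⟨c, rfl⟩ := (h.right_ker b).1 hb
    exact ⟨c, hs.1 (hq' c)⟩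

/-- Every nonzero graded module has a nonzero homogeneous element which is annihilated by the
augmentation ideal. -/
theorem exists_socle (X : GrMod A) (hX : ∃ x : X, x ≠ 0) : ∃ (t : ℤ) (m : X), m ∈ X.deg t ∧ m ≠ 0 ∧
    ∀ a : A, a • m = algebraMap k A (Coalgebra.counit a) • m := by
  obtain ⟨s, y, hy, hy0⟩ : ∃ (s : ℤ) (y : X), y ∈ X.deg s ∧ y ≠ 0 := by
    obtain ⟨x, hx⟩ := hX
    by_contra! hcon
    exact hx (eq_zero_of_proj fun n => hcon n _ (proj_mem X n x))
  obtain ⟨N, hN⟩ := A.exists_deg_eq_bot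
  -- An `a` of the highest degree with `a • y ≠ 0` makes `a • y` vanish under everything of positive
  -- degree.
  obtain ⟨d, ⟨a, ha, hay⟩, hmax⟩ := Int.exists_greatest_of_bdd
    (P := fun d => ∃ a ∈ A.deg d, a • y ≠ 0) ⟨N, by
      rintro d ⟨a, ha, hay⟩
      by_contra! hd
      rw [hN d hd, Submodule.mem_bot] at ha
      rw [ha, zero_smul] at hay
      exact hay rfl⟩
    ⟨0, 1, SetLike.GradedOne.one_mem, by rwa [one_smul]⟩
  refine ⟨d + s, a • y, X.smul_deg d s a ha y hy, hay, fun b => ?_⟩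
  induction b using GrHopf.induction_deg with
  | zero => simp
  | add b b' hb hb' => rw [add_smul, map_add, map_add, add_smul, hb, hb']
  | deg n b hb =>
    rcases lt_trichotomy n 0 with hn | rfl | hn
    · rw [A.deg_neg n hn, Submodule.mem_bot] at hb
      rw [hb]
      simp
    · conv_lhs => rw [GrHopf.eq_smul_one_of_mem hb]
      rw [Algebra.algebraMap_eq_smul_one]
    · rw [A.counit_deg n hn.ne' b hb, map_zero, zero_smul, smul_smul]
      by_contra hne
      have := hmax (n + d) ⟨b * a, SetLike.GradedMul.mul_mem hb ha, hne⟩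
      omega

/-! ### The trivial module. -/

section Trivial

variable {E : GrHopf k}

theorem _root_.GrHopf.IsTrivial.eq_smul_one (hE : E.IsTrivial) (e : E) :
    e = Coalgebra.counit (R := k) e • (1 : E) := by
  obtain ⟨c, rfl⟩ := hE.2 e
  rw [Algebra.algebraMap_eq_smul_one, map_smul, E.counit_one, smul_eq_mul, mul_one]

/-- The inclusion of the trivial module determined by a homogeneous element which is annihilated by
the augmentation ideal. -/
theorem exists_ofSocle (hE : E.IsTrivial) (f : GrHopf.Hom A E) {X : GrMod A} {t : ℤ} {m : X}
    (hm : m ∈ X.deg t) (hm0 : m ≠ 0)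
    (ha : ∀ a : A, a • m = algebraMap k A (Coalgebra.counit a) • m) :
    ∃ ι : twistObj t (resMod f) ⟶ X, Function.Injective (lin ι) ∧ m ∈ LinearMap.range (lin ι) := by
  let F : E → X := fun e => algebraMap k A (Coalgebra.counit e) • m
  have hadd : ∀ e e', F (e + e') = F e + F e' := fun e e' => by
    simp only [F, map_add, add_smul]
  have hsmul : ∀ (a : A) (e : E), F (f a * e) = a • F e := fun a e => by
    simp only [F]
    rw [E.counit_mul, f.counit_apply, mul_comm, map_mul, mul_smul, ← ha, smul_smul, smul_smul,
      Algebra.commutes]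
  let φ : twistObj t (resMod f) ⟶ X :=
    mkHom { toFun := F, map_add' := hadd, map_smul' := hsmul } fun n e he => by
      change algebraMap k A (Coalgebra.counit (R := k) (A := E) e) • m ∈ X.deg n
      by_cases hn : n = t
      · subst hn
        have := X.smul_deg 0 n (algebraMap k A (Coalgebra.counit (R := k) (A := E) e))
          (by rw [A.deg_zero, Algebra.algebraMap_eq_smul_one]
              exact Submodule.smul_mem _ _ (Submodule.mem_span_singleton_self 1)) m hm
        rwa [zero_add] at this
      · rw [E.counit_deg (n - t) (by omega) e he, map_zero, zero_smul]
        exact zero_mem _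
  refine ⟨φ, (injective_iff_map_eq_zero _).2 ?_, ⟨(1 : E), ?_⟩⟩
  · intro e he
    change algebraMap k A (Coalgebra.counit (R := k) (A := E) e) • m = 0 at he
    by_cases hc : Coalgebra.counit (R := k) (A := E) e = 0
    · rw [show e = _ from hE.eq_smul_one e, hc]
      exact zero_smul k (1 : E)
    · exfalso
      apply hm0
      have := congrArg (fun z => algebraMap k A (Coalgebra.counit (R := k) (A := E) e)⁻¹ • z) he
      simp only [smul_zero] at this
      rwa [smul_smul, ← map_mul, inv_mul_cancel₀ hc, map_one, one_smul] at this
  · change algebraMap k A (Coalgebra.counit (R := k) (1 : E)) • m = m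
    rw [E.counit_one, map_one, one_smul]

/-- Every module is an iterated extension of twists of the trivial module. -/
theorem prop_of_trivial (hE : E.IsTrivial) (f : GrHopf.Hom A E) {P : ObjectProperty (StMod A)}
    (hP : StMod.IsThick P) (h : ∀ t, P ((StMod.Q A).obj (twistObj t (resMod f)))) (X : GrMod A) :
    P ((StMod.Q A).obj X) := by
  suffices H : ∀ (N : Submodule A X) (Y : GrMod A) (g : X ⟶ Y), Function.Surjective (lin g) →
      LinearMap.ker (lin g) = N → P ((StMod.Q A).obj Y) by
    exact H _ X (𝟙 X) Function.surjective_id rfl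
  -- Noetherian induction on the kernel of a quotient map `X → Y`: dividing `Y` by a copy of the
  -- trivial module in its socle enlarges the kernel.
  intro N
  induction N using WellFoundedGT.induction with
  | ind N ih =>
    intro Y g hg hN
    by_cases hY : ∃ y : Y, y ≠ 0
    · obtain ⟨t, m, hm, hm0, ha⟩ := exists_socle Y hY
      obtain ⟨ι, hι, hmem⟩ := exists_ofSocle hE f hm hm0 ha
      have hs := isShortExact_coker ι hι
      refine hP.middle _ _ (.of_isShortExact hs) (h t)
        (ih (LinearMap.ker (lin (g ≫ cokerπ ι))) ?_ _ (g ≫ cokerπ ι) (hs.2.2.comp hg) rfl)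
      rw [lt_iff_le_not_ge]
      constructor
      · rw [← hN]
        intro x hx
        rw [LinearMap.mem_ker] at hx ⊢
        rw [lin_comp, LinearMap.comp_apply, hx, map_zero]
      · intro hle
        obtain ⟨x, rfl⟩ := hg m
        obtain ⟨e, he⟩ := hmem
        have hx : x ∈ LinearMap.ker (lin (g ≫ cokerπ ι)) := by
          rw [LinearMap.mem_ker, lin_comp, LinearMap.comp_apply, ← he]
          exact hs.zero e
        have := hle hx
        rw [← hN] at this
        exact hm0 this
    · push Not at hY
      have : Subsingleton Y := ⟨fun a b => (hY a).trans (hY b).symm⟩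
      exact hP.zero _ (StMod.isZero_of_projective Module.Projective.of_free)

/-- Let `a ≠ 0` have top degree, which is positive, so that `a z = ε(z) a` for all `z`. A section of
`A → k` would send `1` to some `e` with `ε(e) = 1`, and linearity gives `a e = 0`, contradicting `a
e = a`. -/
theorem not_projective_trivial (hA : ¬ A.IsTrivial) (hE : E.IsTrivial) (f : GrHopf.Hom A E) :
    ¬ Module.Projective A (resMod f) := by
  intro hproj
  have hpos : ∃ d, 0 < d ∧ ∃ a ∈ A.deg d, a ≠ 0 := by
    by_contra! hcon
    apply hA
    refine ⟨?_, fun a => ⟨Coalgebra.counit a, ?_⟩⟩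
    · intro c c' h
      have := congrArg (Coalgebra.counit (R := k)) h
      rwa [Algebra.algebraMap_eq_smul_one, Algebra.algebraMap_eq_smul_one, map_smul, map_smul,
        A.counit_one, smul_eq_mul, smul_eq_mul, mul_one, mul_one] at this
    · rw [Algebra.algebraMap_eq_smul_one]
      induction a using GrHopf.induction_deg with
      | zero => simp
      | add a b ha hb => rw [map_add, add_smul, ha, hb]
      | deg n a ha =>
        rcases lt_trichotomy n 0 with hn | rfl | hn
        · rw [A.deg_neg n hn, Submodule.mem_bot] at ha
          simp [ha]
        · exact (GrHopf.eq_smul_one_of_mem ha).symm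
        · simp [hcon n hn a ha]
  obtain ⟨N, hN⟩ := A.exists_deg_eq_bot
  obtain ⟨d, ⟨hd, a, ha, ha0⟩, hmax⟩ := Int.exists_greatest_of_bdd
    (P := fun d => 0 < d ∧ ∃ a ∈ A.deg d, a ≠ 0) ⟨N, by
      rintro d ⟨-, a, ha, ha0⟩
      by_contra! hd
      rw [hN d hd, Submodule.mem_bot] at ha
      exact ha0 ha⟩ hpos
  have haz : ∀ z : A, a * z = Coalgebra.counit (R := k) z • a := by
    intro z
    induction z using GrHopf.induction_deg with
    | zero => simp
    | add z z' hz hz' => rw [mul_add, map_add, add_smul, hz, hz']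
    | deg n z hz =>
      rcases lt_trichotomy n 0 with hn | rfl | hn
      · rw [A.deg_neg n hn, Submodule.mem_bot] at hz
        simp [hz]
      · conv_lhs => rw [GrHopf.eq_smul_one_of_mem hz, mul_smul_comm, mul_one]
      · rw [A.counit_deg n hn.ne' z hz, zero_smul]
        by_contra hne
        have := hmax (d + n) ⟨by omega, a * z, SetLike.GradedMul.mul_mem ha hz, hne⟩
        omega
  let π : A →ₗ[A] resMod f := LinearMap.toSpanSingleton A (resMod f) (1 : E)
  have hπ : ∀ z : A, π z = f z := fun z => mul_one (M := E) (f z)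
  have hsurj : Function.Surjective π := by
    intro e
    refine ⟨algebraMap k A (Coalgebra.counit (R := k) (A := E) e), (hπ _).trans ?_⟩
    rw [show e = _ from hE.eq_smul_one e, map_smul, E.counit_one, smul_eq_mul, mul_one,
      ← Algebra.algebraMap_eq_smul_one]
    exact (f.toBialgHom : A →ₐ[k] E).commutes _
  obtain ⟨s, hs⟩ := π.exists_rightInverse_of_surjective (LinearMap.range_eq_top.2 hsurj)
  let e : A := s (1 : E)
  have he : f e = 1 := (hπ e).symm.trans (LinearMap.congr_fun hs (1 : E))
  have hce : Coalgebra.counit (R := k) e = 1 := by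
    rw [← f.counit_apply, he, E.counit_one]
  have hae : a * e = 0 := by
    have h1 : a * e = s (f a) := (map_smul s a (show resMod f from (1 : E))).symm.trans
      (congrArg s (mul_one (f a)))
    have h2 : f a = 0 := by
      rw [hE.eq_smul_one (f a), f.counit_apply, A.counit_deg d hd.ne' a ha, zero_smul]
    rw [h1, h2]
    exact map_zero s
  rw [haz, hce, one_smul] at hae
  exact ha0 hae

end Trivial

end GrMod

/-! ### Towers -/

namespace HopfTower

variable {k : Type u} [Field k] {A : GrHopf k} {ℓ : ℕ} (T : HopfTower A ℓ)

/-- The projection `A_j → A_{j+1}`. -/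
def projStage (j : Fin (ℓ + 1)) : GrHopf.Hom (T.stage j.castSucc) (T.stage j.succ) := T.proj j

theorem exists_isTruncated (j : Fin (ℓ + 1)) :
    ∃ (d : ℤ) (x : T.stage j.castSucc) (N : ℕ), GrHopf.IsTruncated (T.projStage j) d x N :=
  (T.isExtension j).exists_isTruncated (T.isMonogenic j)

theorem isTrivial_stage_last : (T.stage (Fin.last (ℓ + 1))).IsTrivial := T.isTrivial_last

/-- The induction runs down from `A_{ℓ+1} = k`, since the property passes from the quotient to the
extension. -/
theorem isFrobenius_stage (j : Fin (ℓ + 2)) : (T.stage j).IsFrobenius := by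
  induction j using Fin.reverseInduction with
  | last => exact GrHopf.isFrobenius_of_isTrivial T.isTrivial_stage_last
  | cast j ih =>
    obtain ⟨d, x, N, h⟩ := T.exists_isTruncated j
    exact h.isFrobenius ih

theorem isFrobenius (T : HopfTower A ℓ) : A.IsFrobenius := T.isFrobenius_stage 0

theorem projective_stageMod_zero : Module.Projective A (T.stageMod 0) :=
  inferInstanceAs (Module.Projective A A)

open GrMod in
theorem exists_sequences (j : Fin (ℓ + 1)) : ∃ D d : ℤ, 0 < D ∧ ∀ s : ℤ,
    ∃ (K : GrMod A) (f : K ⟶ twistObj s (T.stageMod j.castSucc))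
      (g : twistObj s (T.stageMod j.castSucc) ⟶ twistObj s (T.stageMod j.succ))
      (f' : twistObj (s + D) (T.stageMod j.succ) ⟶ twistObj (s + d) (T.stageMod j.castSucc))
      (g' : twistObj (s + d) (T.stageMod j.castSucc) ⟶ K),
      IsShortExact f g ∧ IsShortExact f' g' := by
  obtain ⟨d, x, N, h⟩ := T.exists_isTruncated j
  refine ⟨(N + 1) * d, d, mul_pos (by positivity) h.pos, fun s => ?_⟩
  obtain ⟨K, ι, ρ, q, h1, h2⟩ := GrMod.exists_sequences h (T.toStage j.castSucc)
  rw [← twistObj_twistObj, ← twistObj_twistObj]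
  exact ⟨_, _, _, _, _, h1.twist s, h2.twist s⟩

end HopfTower

/-! ### Polynomial growth of the number of cells -/

namespace StMod

open GrMod

variable {k : Type u} [Field k] {A : GrHopf k}

theorem IsCofiberSeq.twist {X Y Z : StMod A} {f : X ⟶ Y} {g : Y ⟶ Z} (h : IsCofiberSeq f g)
    (t : ℤ) : IsCofiberSeq ((StMod.twist A t).map f) ((StMod.twist A t).map g) := by
  obtain ⟨X', Y', Z', i, p, hip, a, b, c, h1, h2⟩ := h
  refine ⟨_, _, _, _, _, hip.twist t, (StMod.twist A t).mapIso a, (StMod.twist A t).mapIso b,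
    (StMod.twist A t).mapIso c, ?_, ?_⟩
  · exact ((StMod.twist A t).map_comp _ _).symm.trans
      ((congrArg (StMod.twist A t).map h1).trans ((StMod.twist A t).map_comp _ _))
  · exact ((StMod.twist A t).map_comp _ _).symm.trans
      ((congrArg (StMod.twist A t).map h2).trans ((StMod.twist A t).map_comp _ _))

/-- The number of cells which are necessary to construct the twists of `Y` grows at most like a
polynomial of degree `e`. -/
def Grows (G : StMod A) (e : ℕ) (Y : StMod A) : Prop :=
  ∀ t : ℤ, ∃ c : ℕ, ∀ n : ℕ, ∃ m ≤ c * (n + 1) ^ e, Built G m (twistObj (t + n) Y.as)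

variable {G : StMod A} {e : ℕ}

/-- Twisting preserves cofiber sequences, so costs add and the degree `e` is kept. The constant may
depend on the starting twist `t`, which makes the class closed under twists as well. -/
theorem isThick_grows (hA : A.IsFrobenius) (G : StMod A) (e : ℕ) : IsThick (Grows G e) where
  zero X hX t := ⟨0, fun n => ⟨0, Nat.zero_le _,
    .proj (show Module.Projective A X.as from (isThick_projective hA).zero X hX)⟩⟩
  left := by
    intro X Y Z f g h hY hZ t
    obtain ⟨c, hc⟩ := hY t
    obtain ⟨c', hc'⟩ := hZ t
    refine ⟨c' + c, fun n => ?_⟩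
    obtain ⟨m, hm, hb⟩ := hc n
    obtain ⟨m', hm', hb'⟩ := hc' n
    exact ⟨m' + m, by rw [add_mul]; exact add_le_add hm' hm, (h.twist (t + n)).built_left hb hb'⟩
  middle := by
    intro X Y Z f g h hX hZ t
    obtain ⟨c, hc⟩ := hX t
    obtain ⟨c', hc'⟩ := hZ t
    refine ⟨c + c', fun n => ?_⟩
    obtain ⟨m, hm, hb⟩ := hc n
    obtain ⟨m', hm', hb'⟩ := hc' n
    exact ⟨m + m', by rw [add_mul]; exact add_le_add hm hm',
      (h.twist (t + n)).built_middle hb hb'⟩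
  right := by
    intro X Y Z f g h hX hY t
    obtain ⟨c, hc⟩ := hX t
    obtain ⟨c', hc'⟩ := hY t
    refine ⟨c' + c, fun n => ?_⟩
    obtain ⟨m, hm, hb⟩ := hc n
    obtain ⟨m', hm', hb'⟩ := hc' n
    exact ⟨m' + m, by rw [add_mul]; exact add_le_add hm' hm,
      (h.twist (t + n)).built_right hA hb hb'⟩
  retract := by
    intro X Y h hY t
    obtain ⟨c, hc⟩ := hY t
    refine ⟨c, fun n => ?_⟩
    obtain ⟨m, hm, hb⟩ := hc n
    exact ⟨m, hm, Built.of_retract (h.map (StMod.twist A (t + n))) hb⟩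

theorem Grows.twist {Y : StMod A} (h : Grows G e Y) (s : ℤ) :
    Grows G e ((StMod.twist A s).obj Y) := by
  intro t
  obtain ⟨c, hc⟩ := h (t + s)
  refine ⟨c, fun n => ?_⟩
  obtain ⟨m, hm, hb⟩ := hc n
  refine ⟨m, hm, ?_⟩
  change Built G m (twistObj (t + n) (twistObj s Y.as))
  rw [twistObj_twistObj]
  rwa [add_right_comm] at hb

/-- This is where each `b_i` saves one degree. -/
theorem Grows.of_thick (hA : A.IsFrobenius) {Y Z : StMod A} (h : Grows G e Y) {S : Finset ℤ}
    (hZ : thick {X : StMod A | ∃ t ∈ S, X = (StMod.twist A t).obj Y} Z) : Grows G e Z :=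
  hZ _ (isThick_grows hA G e) (by
    rintro _ ⟨t, -, rfl⟩
    exact h.twist t)

theorem exists_built (hA : A.IsFrobenius) (hG : IsGenerator G) (Y : GrMod A) :
    ∃ m, Built G m Y := by
  refine hG ((Q A).obj Y) _ (isThick_built hA) ?_
  rintro _ rfl
  exact ⟨1, .shift (.zero (Iso.refl _))⟩

/-- A function which is defined recursively with period `D` and polynomial increments. -/
theorem exists_bound_of_step {P : ℕ → ℕ → Prop} {D : ℕ} (hD : 0 < D) (hP : ∀ n, ∃ m, P n m)
    (c : ℕ) (hstep : ∀ n a, P n a → ∃ a' ≤ a + c * (n + 1) ^ e, P (n + D) a') :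
    ∃ c', ∀ n, ∃ m ≤ c' + c * (n * (n + 1) ^ e), P n m := by
  choose m hm using hP
  -- The sum dominates the initial values at `0, …, D - 1`, from which every `n` is reached by steps
  -- of length `D`.
  refine ⟨∑ i ∈ Finset.range D, m i, fun n => ?_⟩
  induction n using Nat.strong_induction_on with
  | _ n ih =>
    rcases lt_or_ge n D with hn | hn
    · exact ⟨m n, le_add_right (Finset.single_le_sum (f := m) (fun _ _ => Nat.zero_le _)
        (Finset.mem_range.2 hn)), hm n⟩
    · obtain ⟨n, rfl⟩ := Nat.exists_eq_add_of_le' hn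
      obtain ⟨a, ha, hPa⟩ := ih n (by omega)
      obtain ⟨a', ha', hPa'⟩ := hstep n a hPa
      refine ⟨a', ha'.trans ((Nat.add_le_add_right ha _).trans ?_), hPa'⟩
      rw [add_assoc, ← mul_add]
      gcongr
      calc n * (n + 1) ^ e + (n + 1) ^ e = (n + 1) * (n + 1) ^ e := by ring
        _ ≤ (n + D) * (n + D + 1) ^ e := by gcongr <;> omega

variable {ℓ : ℕ} (T : HopfTower A ℓ)

theorem exists_bound_stage (hG : IsGenerator G) (j : Fin (ℓ + 1)) {c : ℤ → ℕ}
    (hc : ∀ (t : ℤ) (n : ℕ), ∃ m ≤ c t * (n + 1) ^ e,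
      Built G m (twistObj (t + n) (T.stageMod j.castSucc))) (t : ℤ) :
    ∃ (d : ℤ) (c' : ℕ), ∀ n : ℕ, ∃ m ≤ c' + (c t + c (t + d)) * (n * (n + 1) ^ e),
      Built G m (twistObj (t + n) (T.stageMod j.succ)) := by
  obtain ⟨D, d, hD, hs⟩ := T.exists_sequences j
  lift D to ℕ using hD.le
  refine ⟨d, exists_bound_of_step (D := D) (by exact_mod_cast hD)
    (fun n => exists_built T.isFrobenius hG _) _ fun n a ha => ?_⟩
  obtain ⟨K, f, g, f', g', h1, h2⟩ := hs (t + n)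
  obtain ⟨m, hm, hb⟩ := hc t n
  obtain ⟨m', hm', hb'⟩ := hc (t + d) n
  rw [add_right_comm t d] at hb'
  refine ⟨a + m + m', ?_, ?_⟩
  · rw [add_mul, add_assoc]
    gcongr
  -- The inner step pays for `K`, the outer one for the twist of `A_{j+1}` by `D` more.
  · have := Built.left h2 hb' (Built.left h1 hb ha)
    rwa [add_assoc t, ← Nat.cast_add] at this

/-- `A_0 = A` is projective and costs no cells, so the increments vanish and the cost of the twists
of `A_1` is bounded by its initial values. -/
theorem grows_one (hG : IsGenerator G) :
    Grows G 0 ((Q A).obj (T.stageMod (Fin.succ 0))) := by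
  intro t
  obtain ⟨d, c', hc'⟩ := exists_bound_stage (e := 0) T hG 0 (c := 0)
    (fun t n => ⟨0, Nat.zero_le _, .proj T.projective_stageMod_zero⟩) t
  refine ⟨c', fun n => ?_⟩
  obtain ⟨m, hm, hb⟩ := hc' n
  exact ⟨m, by simpa using hm, hb⟩

theorem Grows.succ (hG : IsGenerator G) (j : Fin (ℓ + 1))
    (h : Grows G e ((Q A).obj (T.stageMod j.castSucc))) :
    Grows G (e + 1) ((Q A).obj (T.stageMod j.succ)) := by
  choose c hc using h
  intro t
  obtain ⟨d, c', hc'⟩ := exists_bound_stage T hG j hc t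
  refine ⟨c' + (c t + c (t + d)), fun n => ?_⟩
  obtain ⟨m, hm, hb⟩ := hc' n
  refine ⟨m, hm.trans ?_, hb⟩
  rw [add_mul c']
  refine add_le_add (Nat.le_mul_of_pos_right _ (Nat.pow_pos n.succ_pos)) (Nat.mul_le_mul_left _ ?_)
  rw [_root_.pow_succ', add_mul]
  exact Nat.le_add_right _ _

/-- The index is shifted: `Fin.succ j` is the stage `A_{j+1}`, whose degree is `j` minus the number
of free storeys `b_i ≤ j`. -/
theorem grows_stage (hG : IsGenerator G) {h : ℕ} {b : Fin h → ℕ} (hmono : StrictMono b)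
    (hpos : ∀ i, 1 ≤ b i)
    (hthick : ∀ (i) (h₁ : b i < ℓ + 2) (h₂ : b i + 1 < ℓ + 2), ∃ S : Finset ℤ,
      thick {X : StMod A | ∃ t ∈ S, X = (StMod.twist A t).obj
          ((Q A).obj (T.stageMod ⟨b i, h₁⟩))}
        ((Q A).obj (T.stageMod ⟨b i + 1, h₂⟩)))
    (j : ℕ) (hj : j < ℓ + 1) : ∃ e, e + (Finset.univ.filter fun i => b i ≤ j).card = j ∧
      Grows G e ((Q A).obj (T.stageMod (Fin.succ ⟨j, hj⟩))) := by
  induction j with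
  | zero =>
    refine ⟨0, ?_, grows_one T hG⟩
    rw [zero_add, Finset.card_eq_zero, Finset.filter_eq_empty_iff]
    intro i _
    have := hpos i
    omega
  | succ j ih =>
    obtain ⟨e, he, hg⟩ := ih (by omega)
    by_cases hi : ∃ i, b i = j + 1
    · obtain ⟨i, hi⟩ := hi
      have hcard : (Finset.univ.filter fun i => b i ≤ j + 1) =
          insert i (Finset.univ.filter fun i => b i ≤ j) := by
        ext i'
        simp only [Finset.mem_filter, Finset.mem_univ, true_and, Finset.mem_insert]
        rw [← hmono.injective.eq_iff, hi]
        omega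
      refine ⟨e, ?_, ?_⟩
      · rw [hcard, Finset.card_insert_of_notMem (by simp [hi])]
        omega
      · obtain ⟨S, hS⟩ := hthick i (by omega) (by omega)
        simp only [hi] at hS
        exact hg.of_thick T.isFrobenius hS
    · refine ⟨e + 1, ?_, Grows.succ T hG ⟨j + 1, hj⟩ hg⟩
      have hcard : (Finset.univ.filter fun i => b i ≤ j + 1) =
          Finset.univ.filter fun i => b i ≤ j := by
        ext i'
        simp only [Finset.mem_filter, Finset.mem_univ, true_and]
        have : b i' ≠ j + 1 := fun h => hi ⟨i', h⟩
        omega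
      rw [hcard]
      omega

theorem grows_all (hG : IsGenerator G) {h : ℕ} {b : Fin h → ℕ} (hmono : StrictMono b)
    (hpos : ∀ i, 1 ≤ b i) (hlt : ∀ i, b i < ℓ)
    (hthick : ∀ (i) (h₁ : b i < ℓ + 2) (h₂ : b i + 1 < ℓ + 2), ∃ S : Finset ℤ,
      thick {X : StMod A | ∃ t ∈ S, X = (StMod.twist A t).obj
          ((Q A).obj (T.stageMod ⟨b i, h₁⟩))}
        ((Q A).obj (T.stageMod ⟨b i + 1, h₂⟩))) :
    ∃ e, e + h = ℓ ∧ ∀ X : StMod A, Grows G e X := by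
  obtain ⟨e, he, hg⟩ := grows_stage T hG hmono hpos hthick ℓ (by omega)
  refine ⟨e, ?_, fun X => prop_of_trivial T.isTrivial_stage_last
    (T.toStage (Fin.last (ℓ + 1))) (isThick_grows T.isFrobenius G e) (fun t => hg.twist t) X.as⟩
  rwa [Finset.filter_true_of_mem (fun i _ => (hlt i).le), Finset.card_univ, Fintype.card_fin] at he

/-! ### Existence of a generator -/

theorem exists_thick_finite {S : Set (GrMod A)} (hS : S.Finite) :
    ∃ G : GrMod A, ∀ X ∈ S, ∀ P : ObjectProperty (StMod A), IsThick P → P ((Q A).obj G) →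
      P ((Q A).obj X) := by
  induction S, hS using Set.Finite.induction_on with
  | empty => exact ⟨zeroMod A, by simp⟩
  | @insert Y S _ _ ih =>
    obtain ⟨G, hG⟩ := ih
    refine ⟨prod Y G, ?_⟩
    rintro X (rfl | hX) P hP h
    · exact hP.retract ⟨(Q A).map (inl X G), (Q A).map (fst X G), by
        rw [← (Q A).map_comp, inl_fst, (Q A).map_id]⟩ h
    · refine hG X hX P hP (hP.retract ⟨(Q A).map (inr Y G), (Q A).map (snd Y G), ?_⟩ h)
      rw [← (Q A).map_comp, show inr Y G ≫ snd Y G = 𝟙 G from rfl, (Q A).map_id]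

/-- Once all twists of `A_j` are available, the two sequences show that `A_{j+1}(s)` lies in a thick
subcategory if and only if `A_{j+1}(s + D_j)` does. So finitely many twists, one for each residue
modulo `D_j`, suffice. -/
theorem exists_generator (T : HopfTower A ℓ) : ∃ G : StMod A, IsGenerator G := by
  choose D d hD hs using T.exists_sequences
  let S : Set (GrMod A) := ⋃ j : Fin (ℓ + 1), (fun r : ℤ => twistObj r (T.stageMod j.succ)) ''
    Set.Icc 0 (D j)
  have hS : S.Finite := Set.finite_iUnion fun j => (Set.finite_Icc _ _).image _
  obtain ⟨G, hG⟩ := exists_thick_finite hS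
  refine ⟨(Q A).obj G, fun X => ?_⟩
  have hP := isThick_thick ({(Q A).obj G} : Set (StMod A))
  set P := thick ({(Q A).obj G} : Set (StMod A))
  have hPG : P ((Q A).obj G) := fun _ _ h => h _ rfl
  have hstage : ∀ (j : Fin (ℓ + 2)) (t : ℤ), P ((Q A).obj (twistObj t (T.stageMod j))) := by
    intro j
    induction j using Fin.induction with
    | zero => exact fun t => hP.zero _ (isZero_of_projective T.projective_stageMod_zero)
    | succ j ih =>
      intro t
      have hbase : P ((Q A).obj (twistObj (t % D j) (T.stageMod j.succ))) := by
        refine hG _ (Set.mem_iUnion.2 ⟨j, t % D j, ⟨Int.emod_nonneg _ (hD j).ne', ?_⟩, rfl⟩) P hP hPG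
        exact (Int.emod_lt_of_pos _ (hD j)).le
      have hiff : ∀ s, P ((Q A).obj (twistObj s (T.stageMod j.succ))) ↔
          P ((Q A).obj (twistObj (s + D j) (T.stageMod j.succ))) := by
        intro s
        obtain ⟨K, f, g, f', g', h1, h2⟩ := hs j s
        exact ⟨fun h => hP.left _ _ (.of_isShortExact h2) (ih _)
            (hP.left _ _ (.of_isShortExact h1) (ih _) h),
          fun h => hP.right _ _ (.of_isShortExact h1)
            (hP.right _ _ (.of_isShortExact h2) h (ih _)) (ih _)⟩
      have hall : ∀ q : ℤ, P ((Q A).obj (twistObj (t % D j + q * D j) (T.stageMod j.succ))) := by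
        intro q
        induction q using Int.induction_on with
        | zero => simpa using hbase
        | succ q hq =>
          have := (hiff _).1 hq
          rwa [add_assoc, ← add_one_mul] at this
        | pred q hq =>
          refine (hiff _).2 ?_
          rwa [add_assoc, ← add_one_mul, sub_add_cancel]
      have := hall (t / D j)
      rwa [Int.emod_add_ediv_mul] at this
  exact prop_of_trivial T.isTrivial_stage_last (T.toStage (Fin.last (ℓ + 1))) hP
    (hstage (Fin.last (ℓ + 1))) X.as

theorem IsGenerator.not_projective (T : HopfTower A ℓ) (hA : ¬ A.IsTrivial) (hG : IsGenerator G) :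
    ¬ Module.Projective A G.as := by
  intro h
  refine not_projective_trivial hA T.isTrivial_stage_last (T.toStage (Fin.last (ℓ + 1))) ?_
  refine hG ((Q A).obj (resMod (T.toStage (Fin.last (ℓ + 1))))) _
    (isThick_projective T.isFrobenius) ?_
  rintro _ rfl
  exact h

theorem tw_iterate (G : StMod A) (n : ℕ) :
    (tw A).obj^[n] G = (StMod.twist A n).obj G := by
  induction n with
  | zero =>
    change G = ⟨twistObj ((0 : ℕ) : ℤ) G.as⟩
    rw [Nat.cast_zero, twistObj_zero]
  | succ n ih =>
    rw [Function.iterate_succ_apply', ih]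
    change (⟨twistObj 1 (twistObj n G.as)⟩ : StMod A) = ⟨twistObj ((n + 1 : ℕ) : ℤ) G.as⟩
    rw [twistObj_twistObj, Nat.cast_add, add_comm, Nat.cast_one]

end StMod

/-! ### Entropy -/

namespace StMod

variable {k : Type u} [Field k] {A : GrHopf k}

/-- The lower bound on complexity makes the categorical entropy nonnegative, so subtracting it only
helps; its vanishing is not needed. -/
theorem polEntropy_le {F : StMod A ⥤ StMod A} {G : StMod A} {c e : ℕ}
    (h1 : ∀ n, 1 ≤ complexity G (F.obj^[n] G))
    (h2 : ∀ n, complexity G (F.obj^[n] G) ≤ (c * (n + 1) ^ e : ℕ)) :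
    polEntropy F G ≤ ((e : ℝ) : EReal) := by
  have hc : 0 < c := by
    rcases Nat.eq_zero_or_pos c with rfl | hc
    · have := (h1 0).trans (h2 0)
      simp at this
    · exact hc
  have hlog1 : ∀ n, 0 ≤ logComplexity F G n := fun n => by
    rw [logComplexity, ENNReal.zero_le_log_iff]
    exact_mod_cast h1 n
  have hlog2 : ∀ n : ℕ, 1 ≤ n →
      logComplexity F G n ≤ ((Real.log (c * 2 ^ e) + e * Real.log n : ℝ) : EReal) := by
    intro n hn
    have hn0 : (0 : ℝ) < n := by exact_mod_cast hn
    have hc0 : (0 : ℝ) < c := by exact_mod_cast hc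
    -- For `n ≥ 1` one has `n + 1 ≤ 2 n`, which makes the logarithm a constant plus `e log n`.
    have h3 : c * (n + 1) ^ e ≤ c * 2 ^ e * n ^ e := by
      rw [mul_assoc, ← mul_pow]
      gcongr
      omega
    have h4 : ((complexity G (F.obj^[n] G) : ℕ∞) : ENNReal) ≤
        ENNReal.ofReal (c * 2 ^ e * n ^ e) := by
      have h5 : complexity G (F.obj^[n] G) ≤ ((c * 2 ^ e * n ^ e : ℕ) : ℕ∞) :=
        (h2 n).trans (by exact_mod_cast h3)
      have h6 : ENNReal.ofReal (c * 2 ^ e * n ^ e) = ((c * 2 ^ e * n ^ e : ℕ) : ENNReal) := by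
        rw [← ENNReal.ofReal_natCast]
        push_cast
        rfl
      rw [h6]
      exact_mod_cast h5
    refine (ENNReal.log_le_log h4).trans_eq ?_
    rw [ENNReal.log_ofReal_of_pos (by positivity), Real.log_mul (by positivity) (by positivity),
      Real.log_pow]
  have hent : 0 ≤ catEntropy F G := by
    have h : ∀ n : ℕ, (0 : EReal) ≤ logComplexity F G n / (n : EReal) := fun n =>
      EReal.div_nonneg (hlog1 n) (by exact_mod_cast Nat.zero_le n)
    exact (limsup_const (0 : EReal)).symm.le.trans (limsup_le_limsup (Eventually.of_forall h))
  have hlim : Tendsto (fun n : ℕ =>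
      (((Real.log (c * 2 ^ e) / Real.log n + e : ℝ)) : EReal)) atTop (nhds ((e : ℝ) : EReal)) := by
    refine (continuous_coe_real_ereal.tendsto _).comp ?_
    have := (tendsto_const_nhds (x := Real.log (c * 2 ^ e))).div_atTop
      (Real.tendsto_log_atTop.comp tendsto_natCast_atTop_atTop)
    simpa using this.add_const (e : ℝ)
  refine (limsup_le_limsup ?_).trans_eq hlim.limsup_eq
  -- From `n = 2` on, the denominator `log n` is positive.
  filter_upwards [eventually_ge_atTop 2] with n hn
  have hlogn : 0 < Real.log n := Real.log_pos (by exact_mod_cast hn)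
  have h3 : logComplexity F G n - (n : EReal) * catEntropy F G ≤
      ((Real.log (c * 2 ^ e) + e * Real.log n : ℝ) : EReal) := by
    refine le_trans ?_ (hlog2 n (by omega))
    have : (0 : EReal) ≤ (n : EReal) * catEntropy F G :=
      mul_nonneg (by exact_mod_cast Nat.zero_le n) hent
    simpa using EReal.sub_le_sub (le_refl (logComplexity F G n)) this
  refine (EReal.div_le_div_right_of_nonneg (by exact_mod_cast hlogn.le) h3).trans_eq ?_
  rw [← EReal.coe_div, add_div, mul_div_assoc, div_self hlogn.ne', mul_one]

end StMod

end

theorem mainTheorem7 {k : Type u} [Field k] (A : GrHopf k) (hA : ¬ A.IsTrivial)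
    (ℓ : ℕ) (T : HopfTower A ℓ)
    (h : ℕ) (b : Fin h → ℕ) (hmono : StrictMono b) (hpos : ∀ i, 1 ≤ b i) (hlt : ∀ i, b i < ℓ)
    (hthick : ∀ i, ∃ S : Finset ℤ,
      StMod.thick {X : StMod A | ∃ t ∈ S, X = (StMod.twist A t).obj
          ((StMod.Q A).obj (T.stageMod ⟨b i, by have := hlt i; omega⟩))}
        ((StMod.Q A).obj (T.stageMod ⟨b i + 1, by have := hlt i; omega⟩))) :
    (∃ G : StMod A, StMod.IsGenerator G) ∧
      ∀ G : StMod A, StMod.IsGenerator G →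
        StMod.polEntropy (StMod.tw A) G ≤ (((ℓ : ℝ) - (h : ℝ) : ℝ) : EReal) := by
  refine ⟨StMod.exists_generator T, fun G hG => ?_⟩
  obtain ⟨e, he, hgrow⟩ := StMod.grows_all T hG hmono hpos hlt fun i _ _ => hthick i
  obtain ⟨c, hc⟩ := hgrow G 0
  have hnot := hG.not_projective T hA
  have hle : StMod.polEntropy (StMod.tw A) G ≤ ((e : ℝ) : EReal) := by
    refine StMod.polEntropy_le (c := c) (fun n => ?_) fun n => ?_
    · rw [StMod.tw_iterate]
      exact StMod.one_le_complexity hnot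
    · obtain ⟨m, hm, hb⟩ := hc n
      rw [zero_add] at hb
      rw [StMod.tw_iterate]
      exact (StMod.Built.complexity_le (Y := (StMod.twist A n).obj G) hb).trans
        (by exact_mod_cast hm)
  refine hle.trans_eq ?_
  rw [← he, Nat.cast_add, add_sub_cancel_right]
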